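/- Let $N\ge 1$, $s\in(0,1)$, and let $p>1$ satisfy $p\le \frac{2N}{N-2s}-1$ in case $2s<N$ (no upper bound if $2s\ge N$). Let $\Omega\subset\mathbb R^N$ be a smooth bounded domain which is convex in the $x_1$-direction and symmetric with respect to the hyperplane $H=\{x\in\mathbb R^N: x_1=0\}$. Put $$\mathcal E(w,v)=\frac{c_{N,s}}2\iint_{\mathbb R^N\times\mathbb R^N}\frac{(w(x)-w(y))(v(x)-v(y))}{|x-y|^{N+2s}}\,dx\,dy,\qquad c_{N,s}=4^s\pi^{-N/2}\frac{\Gamma(\frac N2+s)}{\Gamma(2-s)}s(1-s),$$ $$\mathcal H^s_0(\Omega)=\{w\in H^s(\mathbb R^N): w=0 \text{ in } \mathbb R^N\setminus\Omega\},$$ let $\lambda_1^s(\Omega)=\inf\{\mathcal E(\varphi,\varphi)/\int_\Omega\varphi^2\,dx:\varphi\in\mathcal H^s_0(\Omega)\setminus\{0\}\}$ be the first Dirichlet eigenvalue of $(-\Delta)^s$ in $\Omega$, and let $\lambda>-\lambda_1^s(\Omega)$. Let $u$ be a non-negative weak solution of $(-\Delta)^su+\lambda u=u^p$ in $\Omega$,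 $u=0$ in $\mathbb R^N\setminus\Omega$; that is, $u\in\mathcal H^s_0(\Omega)$, $u\ge 0$ and $\mathcal E(u,\varphi)+\lambda\int_\Omega u\varphi\,dx=\int_\Omega u^p\varphi\,dx$ for all $\varphi\in\mathcal H^s_0(\Omega)$. Put $$\mathcal B(\varphi,\psi)=\mathcal E(\varphi,\psi)+\lambda\int_\Omega\varphi\psi\,dx-\int_\Omega p|u|^{p-1}\varphi\psi\,dx .$$ An eigenfunction with eigenvalue $\mu\in\mathbb R$ of the linearized problem $$(-\Delta)^s\phi+\lambda\phi-p|u|^{p-1}\phi=\mu\phi\ \text{ in }\Omega,\qquad \phi=0\ \text{ in }\mathbb R^N\setminus\Omega,$$ is a function $\phi\in\mathcal H^s_0(\Omega)\setminus\{0\}$ with $\mathcal B(\phi,\psi)=\mu\int_\Omega\phi\psi\,dx$ for all $\psi\in\mathcal H^s_0(\Omega)$. Let $$\mu_1=\min\Big\{\tfrac{\mathcal B(\varphi,\varphi)}{\int_\Omega\varphi^2dx}:\varphi\in\mathcal H^s_0(\Omega)\setminus\{0\}\Big\},\qquad \mu_2=\min\Big\{\tfrac{\mathcal B(\varphi,\varphi)}{\int_\Omega\varphi^2dx}:\varphi\in\mathcal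 H^s_0(\Omega)\setminus\{0\},\ \int_\Omega\phi_1\varphi\,dx=0\Big\}$$ be the first and second eigenvalues, where $\phi_1$ is an eigenfunction with eigenvalue $\mu_1$. A second eigenfunction is an eigenfunction with eigenvalue $\mu_2$. For $x=(x_1,\dots,x_N)$ let $\sigma(x)=(-x_1,x_2,\dots,x_N)$, and for $w:\mathbb R^N\to\mathbb R$ let the polarization $Pw$ of $w$ with respect to $H$ be $$(Pw)(x)=\begin{cases}\min\{w(x),w(\sigma(x))\}, & x_1\ge 0,\\ \max\{w(x),w(\sigma(x))\}, & x_1\le 0.\end{cases}$$ If $v$ is a second eigenfunction of the linearized problem at $u$, then $Pv$ is also a second eigenfunction of the same problem. -/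

import Mathlib

open MeasureTheory
open scoped ContDiff

namespace FractionalDirichlet

noncomputable section

/-- Euclidean space `ℝ^N`. The first coordinate `x₁` of a point `x` is `x 0`. -/
abbrev Space (N : ℕ) : Type := EuclideanSpace ℝ (Fin N)

/-! ### Domains, reflection and polarization -/

/-- The boundary of the open set `Ω` is of class `C^∞`: near each of its boundary points, `Ω` is
a sublevel set of a smooth function whose differential does not vanish there. -/
def HasSmoothBoundary {N : ℕ} (Ω : Set (Space N)) : Prop :=
  ∀ x₀ ∈ frontier Ω, ∃ (U : Set (Space N)) (ρ : Space N → ℝ),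
    IsOpen U ∧ x₀ ∈ U ∧ ContDiffOn ℝ ∞ ρ U ∧ fderiv ℝ ρ x₀ ≠ 0 ∧
      Ω ∩ U = {x | ρ x < 0} ∩ U

/-- A smooth bounded domain of `ℝ^N`: open, connected (and non-empty), bounded, with smooth
boundary. -/
structure IsSmoothBoundedDomain {N : ℕ} (Ω : Set (Space N)) : Prop where
  isOpen : IsOpen Ω
  isConnected : IsConnected Ω
  isBounded : Bornology.IsBounded Ω
  smoothBoundary : HasSmoothBoundary Ω

/-- `Ω` is convex in the `x₁`-direction: it contains the segment between any two of its points
that differ at most in the first coordinate. -/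
def ConvexInFirstDirection {N : ℕ} [NeZero N] (Ω : Set (Space N)) : Prop :=
  ∀ x ∈ Ω, ∀ y ∈ Ω, (∀ i, i ≠ 0 → x i = y i) → segment ℝ x y ⊆ Ω

/-- The reflection `σ(x) = (-x₁, x₂, …, x_N)` with respect to the hyperplane `{x₁ = 0}`. -/
def reflection {N : ℕ} [NeZero N] (x : Space N) : Space N :=
  WithLp.toLp 2 (fun i => if i = 0 then -x i else x i)

/-- `Ω` is symmetric with respect to the hyperplane `{x₁ = 0}`. -/
def SymmetricInFirstDirection {N : ℕ} [NeZero N] (Ω : Set (Space N)) : Prop :=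
  ∀ x, reflection x ∈ Ω ↔ x ∈ Ω

/-- The polarization of `w` with respect to the hyperplane `{x₁ = 0}`: the minimum of `w` and its
reflection where `x₁ ≥ 0`, their maximum where `x₁ ≤ 0` (the two agree where `x₁ = 0`). -/
def polarization {N : ℕ} [NeZero N] (w : Space N → ℝ) (x : Space N) : ℝ :=
  if 0 ≤ x 0 then min (w x) (w (reflection x)) else max (w x) (w (reflection x))

/-! ### Fractional Sobolev spaces and the energy form -/

/-- `w ∈ H^s(ℝ^N)`. Functions are regarded up to equality almost everywhere. -/
def MemHs {N : ℕ} (s : ℝ) (w : Space N → ℝ) : Prop :=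
  MemLp w 2 volume ∧
    MemLp (fun z : Space N × Space N => |w z.1 - w z.2| / ‖z.1 - z.2‖ ^ ((N : ℝ) / 2 + s)) 2 volume

/-- `w ∈ 𝓗^s_0(Ω)`: `w ∈ H^s(ℝ^N)` and `w = 0` (almost everywhere) in `ℝ^N \ Ω`. -/
def MemHs0 {N : ℕ} (Ω : Set (Space N)) (s : ℝ) (w : Space N → ℝ) : Prop :=
  MemHs s w ∧ ∀ᵐ x, x ∉ Ω → w x = 0

/-- The normalizing constant `c_{N,s}` of the fractional Laplacian. -/
def normConst (N : ℕ) (s : ℝ) : ℝ :=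
  4 ^ s * Real.pi ^ (-((N : ℝ) / 2)) * (Real.Gamma ((N : ℝ) / 2 + s) / Real.Gamma (2 - s))
    * s * (1 - s)

/-- The bilinear form `𝓔(w, v)` of the fractional Laplacian `(-Δ)^s`. -/
def energy {N : ℕ} (s : ℝ) (w v : Space N → ℝ) : ℝ :=
  normConst N s / 2 *
    ∫ z : Space N × Space N,
      (w z.1 - w z.2) * (v z.1 - v z.2) / ‖z.1 - z.2‖ ^ ((N : ℝ) + 2 * s)

/-- The first Dirichlet eigenvalue `λ₁^s(Ω)` of `(-Δ)^s` in `Ω`, as the infimum of the Rayleigh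
quotient. -/
def firstDirichletEigenvalue {N : ℕ} (Ω : Set (Space N)) (s : ℝ) : ℝ :=
  sInf {r | ∃ φ : Space N → ℝ, MemHs0 Ω s φ ∧ ¬ φ =ᵐ[volume] 0 ∧
    r = energy s φ φ / ∫ x in Ω, φ x ^ 2}

/-! ### The semilinear problem and its linearization -/

/-- `u` is a non-negative (weak) solution of `(-Δ)^s u + λ u = u^p` in `Ω`, `u = 0` in
`ℝ^N \ Ω`. -/
structure IsNonnegSolution {N : ℕ} (Ω : Set (Space N)) (s lam p : ℝ) (u : Space N → ℝ) :
    Prop where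
  mem : MemHs0 Ω s u
  nonneg : ∀ᵐ x, 0 ≤ u x
  weak_eq : ∀ φ : Space N → ℝ, MemHs0 Ω s φ →
    energy s u φ + lam * ∫ x in Ω, u x * φ x = ∫ x in Ω, u x ^ p * φ x

/-- The bilinear form `𝓑` of the linearized operator `(-Δ)^s + λ - p |u|^{p-1}`. -/
def linForm {N : ℕ} (Ω : Set (Space N)) (s lam p : ℝ) (u φ ψ : Space N → ℝ) : ℝ :=
  energy s φ ψ + (lam * ∫ x in Ω, φ x * ψ x) - ∫ x in Ω, p * |u x| ^ (p - 1) * φ x * ψ x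

/-- `φ` is an eigenfunction with eigenvalue `μ` of the linearized problem at `u`, i.e. a nonzero
weak solution of `(-Δ)^s φ + λ φ - p |u|^{p-1} φ = μ φ` in `Ω`, `φ = 0` in `ℝ^N \ Ω`. -/
structure IsEigenfunction {N : ℕ} (Ω : Set (Space N)) (s lam p : ℝ) (u : Space N → ℝ) (μ : ℝ)
    (φ : Space N → ℝ) : Prop where
  mem : MemHs0 Ω s φ
  ne_zero : ¬ φ =ᵐ[volume] 0
  weak_eq : ∀ ψ : Space N → ℝ, MemHs0 Ω s ψ →
    linForm Ω s lam p u φ ψ = μ * ∫ x in Ω, φ x * ψ x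

/-- `μ = μ₁`, the minimum of `𝓑(φ, φ) / ∫_Ω φ²` over `φ ∈ 𝓗^s_0(Ω) \ {0}`. -/
def IsFirstEigenvalue {N : ℕ} (Ω : Set (Space N)) (s lam p : ℝ) (u : Space N → ℝ) (μ : ℝ) :
    Prop :=
  IsLeast {r | ∃ φ : Space N → ℝ, MemHs0 Ω s φ ∧ ¬ φ =ᵐ[volume] 0 ∧
    r = linForm Ω s lam p u φ φ / ∫ x in Ω, φ x ^ 2} μ

/-- `φ₁` is a first eigenfunction: an eigenfunction with eigenvalue `μ₁`. -/
def IsFirstEigenfunction {N : ℕ} (Ω : Set (Space N)) (s lam p : ℝ) (u φ₁ : Space N → ℝ) : Prop :=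
  ∃ μ₁, IsFirstEigenvalue Ω s lam p u μ₁ ∧ IsEigenfunction Ω s lam p u μ₁ φ₁

/-- `μ = μ₂`, the minimum of `𝓑(φ, φ) / ∫_Ω φ²` over the `φ ∈ 𝓗^s_0(Ω) \ {0}` that are
orthogonal in `L²(Ω)` to the first eigenfunction `φ₁`. -/
def IsSecondEigenvalue {N : ℕ} (Ω : Set (Space N)) (s lam p : ℝ) (u : Space N → ℝ) (μ : ℝ) :
    Prop :=
  ∃ φ₁ : Space N → ℝ, IsFirstEigenfunction Ω s lam p u φ₁ ∧
    IsLeast {r | ∃ φ : Space N → ℝ, MemHs0 Ω s φ ∧ ¬ φ =ᵐ[volume] 0 ∧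
      ∫ x in Ω, φ₁ x * φ x = 0 ∧
      r = linForm Ω s lam p u φ φ / ∫ x in Ω, φ x ^ 2} μ

end

end FractionalDirichlet

open FractionalDirichlet

/-! The polarization `Pv` of a second eigenfunction is again a minimizer of the Rayleigh quotient on
the orthogonal complement of the first eigenfunction `φ₁`, hence a second eigenfunction.

Suppose first that `u` is symmetric with respect to `{x₁ = 0}`. Two points on the same side of the
hyperplane interact more strongly than either of them does with the mirror image of the other, so
rearranging the values of `v` as polarization does cannot increase the energy
(`energy_polarization_le`), while it keeps the `L²` norm and the potential term. First
eigenfunctions have a sign, because `|φ|` has strictly smaller energy than a sign-changing `φ`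
(`ae_or_ae_of_energy_le_abs`). Consequently `μ₁` is simple, `φ₁` is symmetric, `v` is orthogonal to
`φ₁`, and so is `Pv`, as `v` and `Pv` have the same even part
(`IsSecondEigenvalue.isEigenfunction_polarization`). Energies are compared by folding: the double
integral is averaged over the reflections of either variable, and the integrands are compared at
pairs of points in one half-space.

That `u` is symmetric (`IsPreciseSolution.ae_symmetric`) is proved by moving planes in weak form.
With `σ_t` the reflection at `{x₁ = t}`, one shows `u ≤ u ∘ σ_t` on `{x₁ > t}` for all `t ≥ 0`. The
planes move by a maximum principle in sets of small measure
(`IsPreciseSolution.exists_forall_small`), which uses no bound on `u`: since `u ∈ L^{p+1}`, the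
linearized potential is absorbed with the Hölder and the fractional Sobolev inequality (`sobolev`),
also for the critical exponent. To reach smaller `t` one needs the strict inequality almost
everywhere at the current plane, which is the strong maximum principle for antisymmetric functions
(`strong_maximum_principle`); the alternative it leaves, symmetry with respect to `{x₁ = t}` with
`t > 0`, forces `u = 0`. The integrability provided by `sobolev` is also what makes the
linearized form a genuine bilinear form on `H^s`. -/

namespace FractionalDirichlet

noncomputable section

section

/-! ### Difference quotients, `H^s` and the energy form -/

variable {N : ℕ} {s : ℝ}

/-- The fractional difference quotient `(w(x) - w(y)) / |x - y|^{N/2 + s}`, a function of the pair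
`(x, y)` whose `L²` norm is the Gagliardo seminorm of `w`. It is zero on the diagonal. -/
def diffQuot (s : ℝ) (w : Space N → ℝ) (z : Space N × Space N) : ℝ :=
  (w z.1 - w z.2) / ‖z.1 - z.2‖ ^ ((N : ℝ) / 2 + s)

lemma norm_rpow_mul_self (hs : 0 < s) (x : Space N) :
    ‖x‖ ^ ((N : ℝ) / 2 + s) * ‖x‖ ^ ((N : ℝ) / 2 + s) = ‖x‖ ^ ((N : ℝ) + 2 * s) := by
  rw [← Real.rpow_add_of_nonneg (norm_nonneg _) (by positivity) (by positivity)]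
  ring_nf

lemma diffQuot_mul (hs : 0 < s) (w v : Space N → ℝ) (z : Space N × Space N) :
    diffQuot s w z * diffQuot s v z =
      (w z.1 - w z.2) * (v z.1 - v z.2) / ‖z.1 - z.2‖ ^ ((N : ℝ) + 2 * s) := by
  rw [diffQuot, diffQuot, div_mul_div_comm, norm_rpow_mul_self hs]

lemma energy_eq (hs : 0 < s) (w v : Space N → ℝ) :
    energy s w v = normConst N s / 2 * ∫ z, diffQuot s w z * diffQuot s v z := by
  simp only [energy, diffQuot_mul hs]

lemma normConst_pos (hs : 0 < s) (hs1 : s < 1) : 0 < normConst N s := by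
  have h1 : 0 < Real.Gamma ((N : ℝ) / 2 + s) := Real.Gamma_pos_of_pos (by positivity)
  have h2 : 0 < Real.Gamma (2 - s) := Real.Gamma_pos_of_pos (by linarith)
  have h3 : 0 < 1 - s := by linarith
  have := Real.pi_pos
  unfold normConst
  positivity

lemma diffQuot_add (w v : Space N → ℝ) (z) :
    diffQuot s (fun x => w x + v x) z = diffQuot s w z + diffQuot s v z := by
  simp only [diffQuot]; ring

lemma diffQuot_sub (w v : Space N → ℝ) (z) :
    diffQuot s (fun x => w x - v x) z = diffQuot s w z - diffQuot s v z := by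
  simp only [diffQuot]; ring

lemma diffQuot_smul (c : ℝ) (w : Space N → ℝ) (z) :
    diffQuot s (fun x => c * w x) z = c * diffQuot s w z := by
  simp only [diffQuot]; ring

lemma ae_fst {P : Space N → Prop} (h : ∀ᵐ x, P x) :
    ∀ᵐ z : Space N × Space N, P z.1 :=
  (Measure.quasiMeasurePreserving_fst (μ := volume) (ν := volume)).ae h

lemma ae_snd {P : Space N → Prop} (h : ∀ᵐ x, P x) :
    ∀ᵐ z : Space N × Space N, P z.2 :=
  (Measure.quasiMeasurePreserving_snd (μ := volume) (ν := volume)).ae h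

lemma diffQuot_congr {w v : Space N → ℝ} (h : w =ᵐ[volume] v) :
    diffQuot s w =ᵐ[volume] diffQuot s v := by
  filter_upwards [ae_fst h, ae_snd h] with z h1 h2
  simp only [diffQuot, h1, h2]

lemma measurable_norm_rpow (a : ℝ) :
    Measurable fun z : Space N × Space N => ‖z.1 - z.2‖ ^ a := by
  fun_prop

lemma aestronglyMeasurable_diffQuot {w : Space N → ℝ} (hw : AEStronglyMeasurable w) :
    AEStronglyMeasurable (diffQuot s w) :=
  ((hw.comp_fst (ν := volume)).sub (hw.comp_snd (μ := volume))).mul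
    (measurable_norm_rpow ((N : ℝ) / 2 + s)).inv.aestronglyMeasurable |>.congr
    (Filter.Eventually.of_forall fun z => by
      simp only [diffQuot, div_eq_mul_inv, Pi.mul_apply, Pi.sub_apply, Pi.inv_apply])

lemma memHs_iff {w : Space N → ℝ} : MemHs s w ↔ MemLp w 2 ∧ MemLp (diffQuot s w) 2 := by
  refine and_congr_right fun h => ?_
  rw [← memLp_norm_iff (aestronglyMeasurable_diffQuot h.1)]
  have : (fun z : Space N × Space N => ‖diffQuot s w z‖) =
      fun z => |w z.1 - w z.2| / ‖z.1 - z.2‖ ^ ((N : ℝ) / 2 + s) := by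
    funext z
    rw [diffQuot, Real.norm_eq_abs, abs_div, abs_of_nonneg (a := ‖z.1 - z.2‖ ^ _) (by positivity)]
  rw [this]

namespace MemHs

lemma memLp_diffQuot {w : Space N → ℝ} (h : MemHs s w) : MemLp (diffQuot s w) 2 :=
  (memHs_iff.1 h).2

lemma congr {w v : Space N → ℝ} (hw : MemHs s w) (h : w =ᵐ[volume] v) : MemHs s v :=
  memHs_iff.2 ⟨hw.1.ae_eq h, hw.memLp_diffQuot.ae_eq (diffQuot_congr h)⟩

lemma add {w v : Space N → ℝ} (hw : MemHs s w) (hv : MemHs s v) :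
    MemHs s (fun x => w x + v x) := by
  refine memHs_iff.2 ⟨hw.1.add hv.1, ?_⟩
  rw [funext (diffQuot_add w v)]
  exact hw.memLp_diffQuot.add hv.memLp_diffQuot

lemma sub {w v : Space N → ℝ} (hw : MemHs s w) (hv : MemHs s v) :
    MemHs s (fun x => w x - v x) := by
  refine memHs_iff.2 ⟨hw.1.sub hv.1, ?_⟩
  rw [funext (diffQuot_sub w v)]
  exact hw.memLp_diffQuot.sub hv.memLp_diffQuot

lemma const_mul {w : Space N → ℝ} (c : ℝ) (hw : MemHs s w) : MemHs s (fun x => c * w x) := by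
  refine memHs_iff.2 ⟨hw.1.const_mul c, ?_⟩
  rw [funext (diffQuot_smul c w)]
  exact hw.memLp_diffQuot.const_mul c

/-- `H^s` contains every function whose values and increments are dominated by those of
elements of `H^s`. -/
lemma of_dominated {f g h : Space N → ℝ} (hg : MemHs s g) (hh : MemHs s h)
    (hf : AEStronglyMeasurable f) (hfg : ∀ x, |f x| ≤ |g x| + |h x|)
    (hinc : ∀ x y, |f x - f y| ≤ |g x - g y| + |h x - h y|) : MemHs s f := by
  refine memHs_iff.2 ⟨(hg.1.norm.add hh.1.norm).of_le hf (Filter.Eventually.of_forall fun x => ?_),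
    (hg.memLp_diffQuot.norm.add hh.memLp_diffQuot.norm).of_le (aestronglyMeasurable_diffQuot hf)
      (Filter.Eventually.of_forall fun z => ?_)⟩
  · simp only [Pi.add_apply, Real.norm_eq_abs]
    rw [abs_of_nonneg (a := |g x| + |h x|) (by positivity)]
    exact hfg x
  · simp only [Pi.add_apply, Real.norm_eq_abs]
    rw [abs_of_nonneg (a := |diffQuot s g z| + |diffQuot s h z|) (by positivity)]
    simp only [diffQuot, abs_div, ← add_div]
    gcongr
    exact hinc _ _

/-- A normal contraction of an element of `H^s` is in `H^s`. -/
lemma of_contraction {f g : Space N → ℝ} (hg : MemHs s g)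
    (hf : AEStronglyMeasurable f) (hfg : ∀ x, |f x| ≤ |g x|)
    (hinc : ∀ x y, |f x - f y| ≤ |g x - g y|) : MemHs s f :=
  hg.of_dominated hg hf (fun x => (hfg x).trans (le_add_of_nonneg_left (abs_nonneg _)))
    (fun x y => (hinc x y).trans (le_add_of_nonneg_left (abs_nonneg _)))

lemma abs {f : Space N → ℝ} (hf : MemHs s f) : MemHs s (fun x => |f x|) :=
  hf.of_contraction (by simpa using hf.1.1.norm) (fun x => by simp)
    fun x y => abs_abs_sub_abs_le_abs_sub _ _

lemma integrable_diffQuot_mul {w v : Space N → ℝ} (hw : MemHs s w) (hv : MemHs s v) :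
    Integrable fun z => diffQuot s w z * diffQuot s v z :=
  hw.memLp_diffQuot.integrable_mul hv.memLp_diffQuot

lemma integrable_mul {w v : Space N → ℝ} (hw : MemHs s w) (hv : MemHs s v) :
    Integrable fun x => w x * v x :=
  MemLp.integrable_mul hw.1 hv.1

end MemHs

namespace MemHs0

variable {Ω : Set (Space N)}

lemma add {w v : Space N → ℝ} (hw : MemHs0 Ω s w) (hv : MemHs0 Ω s v) :
    MemHs0 Ω s (fun x => w x + v x) := by
  refine ⟨hw.1.add hv.1, ?_⟩
  filter_upwards [hw.2, hv.2] with x h1 h2 h3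
  simp [h1 h3, h2 h3]

lemma const_mul {w : Space N → ℝ} (c : ℝ) (hw : MemHs0 Ω s w) :
    MemHs0 Ω s (fun x => c * w x) := by
  refine ⟨hw.1.const_mul c, ?_⟩
  filter_upwards [hw.2] with x h1 h3
  simp [h1 h3]

lemma sub {w v : Space N → ℝ} (hw : MemHs0 Ω s w) (hv : MemHs0 Ω s v) :
    MemHs0 Ω s (fun x => w x - v x) := by
  refine ⟨hw.1.sub hv.1, ?_⟩
  filter_upwards [hw.2, hv.2] with x h1 h2 h3
  simp [h1 h3, h2 h3]

lemma abs {w : Space N → ℝ} (hw : MemHs0 Ω s w) : MemHs0 Ω s (fun x => |w x|) := by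
  refine ⟨hw.1.abs, ?_⟩
  filter_upwards [hw.2] with x h1 h3
  simp [h1 h3]

end MemHs0

lemma energy_comm (w v : Space N → ℝ) : energy s w v = energy s v w := by
  simp only [energy, mul_comm]

lemma energy_congr {w w' v v' : Space N → ℝ} (hs : 0 < s) (h : w =ᵐ[volume] w')
    (h' : v =ᵐ[volume] v') : energy s w v = energy s w' v' := by
  rw [energy_eq hs, energy_eq hs]
  congr 1
  refine integral_congr_ae ?_
  filter_upwards [diffQuot_congr (s := s) h, diffQuot_congr (s := s) h'] with z h1 h2
  rw [h1, h2]

lemma energy_add_left {w w' v : Space N → ℝ} (hs : 0 < s) (hw : MemHs s w) (hw' : MemHs s w')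
    (hv : MemHs s v) : energy s (fun x => w x + w' x) v = energy s w v + energy s w' v := by
  simp only [energy_eq hs, diffQuot_add, add_mul]
  rw [integral_add (hw.integrable_diffQuot_mul hv) (hw'.integrable_diffQuot_mul hv)]
  ring

lemma energy_sub_left {w w' v : Space N → ℝ} (hs : 0 < s) (hw : MemHs s w) (hw' : MemHs s w')
    (hv : MemHs s v) : energy s (fun x => w x - w' x) v = energy s w v - energy s w' v := by
  simp only [energy_eq hs, diffQuot_sub, sub_mul]
  rw [integral_sub (hw.integrable_diffQuot_mul hv) (hw'.integrable_diffQuot_mul hv)]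
  ring

lemma energy_mul_left (hs : 0 < s) (c : ℝ) (w v : Space N → ℝ) :
    energy s (fun x => c * w x) v = c * energy s w v := by
  simp only [energy_eq hs, diffQuot_smul, mul_assoc]
  rw [integral_const_mul]
  ring

lemma ae_fst_ne_snd [NeZero N] : ∀ᵐ z : Space N × Space N, z.1 ≠ z.2 := by
  rw [ae_iff]
  simp only [ne_eq, not_not]
  rw [Measure.volume_eq_prod, Measure.measure_prod_null
    (measurableSet_eq_fun measurable_fst measurable_snd)]
  refine Filter.Eventually.of_forall fun x => ?_
  have : Prod.mk x ⁻¹' {z : Space N × Space N | z.1 = z.2} = {x} := by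
    ext y; simp [eq_comm]
  change volume (Prod.mk x ⁻¹' {z : Space N × Space N | z.1 = z.2}) = 0
  rw [this]
  have : Nontrivial (Space N) := by
    have : Nonempty (Fin N) := ⟨0⟩
    infer_instance
  simp

lemma ae_or_ae_of_prod {P Q : Space N → Prop}
    (h : ∀ᵐ z : Space N × Space N, ¬ (P z.1 ∧ Q z.2)) : (∀ᵐ x, ¬ P x) ∨ ∀ᵐ x, ¬ Q x := by
  have h1 : volume ({x | P x} ×ˢ {x | Q x}) = 0 :=
    measure_mono_null (fun z hz => not_not.2 ⟨hz.1, hz.2⟩) (ae_iff.1 h)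
  rw [Measure.volume_eq_prod, Measure.prod_prod, mul_eq_zero] at h1
  rcases h1 with h1 | h1
  · exact Or.inl (by rw [ae_iff]; simpa using h1)
  · exact Or.inr (by rw [ae_iff]; simpa using h1)

end

section

/-! ### The fractional Sobolev inequality -/

variable {N : ℕ} {s q : ℝ}

/-- The pointwise inequality behind the Sobolev inequality. If `|f x| = a`, the ball around `x`
whose volume is twice the Chebyshev bound for `{|f| > a / 2}` contains a large set on which `f`
differs from `f x` by at least `a / 2`; this bounds the local Gagliardo energy at `x` from below
when the ball has radius at most `1`, and bounds `a` by the `L^q` norm otherwise. -/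
lemma rpow_le_local_energy [NeZero N] (hs : 0 < s) (hq : 2 < q) (hcrit : N * (q - 2) ≤ 2 * s * q) :
    ∃ C : ℝ, 0 < C ∧ ∀ (f : Space N → ℝ) (J : ℝ), Measurable f → 0 < J →
      ∫⁻ x, ENNReal.ofReal (|f x| ^ q) = ENNReal.ofReal J → ∀ x,
      ENNReal.ofReal (|f x| ^ q) ≤ ENNReal.ofReal (C * J ^ (1 - 2 / q)) *
        ((∫⁻ y, ENNReal.ofReal (diffQuot s f (x, y) ^ 2)) + ENNReal.ofReal (f x ^ 2)) := by
  have hN : (0 : ℝ) < N := by exact_mod_cast Nat.pos_of_ne_zero (NeZero.ne N)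
  have : Nontrivial (Space N) := by
    have : Nonempty (Fin N) := ⟨0⟩
    infer_instance
  set β : ℝ := (volume (Metric.ball (0 : Space N) 1)).toReal with hβ
  have hβ0 : 0 < β := ENNReal.toReal_pos (Metric.measure_ball_pos _ _ one_pos).ne'
    measure_ball_lt_top.ne
  set κ : ℝ := 2 ^ (q + 1) / β with hκ
  have hκ0 : 0 < κ := by positivity
  set θ : ℝ := 1 - 2 / q with hθ
  have hθ0 : 0 < θ := by
    have : 2 / q < 1 := by rw [div_lt_one (by linarith)]; exact hq
    linarith
  have hθs : θ ≤ 2 * s / N := by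
    rw [hθ, le_div_iff₀ hN, sub_mul, div_mul_eq_mul_div, one_mul, sub_le_iff_le_add,
      ← sub_le_iff_le_add', le_div_iff₀ (by linarith)]
    nlinarith
  refine ⟨(8 / β + 1) * κ ^ θ, by positivity, fun f J hf hJ hfJ x => ?_⟩
  rcases eq_or_ne (f x) 0 with hx | hx
  · rw [hx, abs_zero, Real.zero_rpow (by linarith)]
    simp
  set a := |f x| with ha
  have ha0 : 0 < a := abs_pos.2 hx
  set M : ℝ := κ * J / a ^ q with hM
  have haq : 0 < a ^ q := by positivity
  have hM0 : 0 < M := by positivity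
  have key : a ^ q = a ^ 2 * ((κ ^ θ * J ^ θ) * M ^ (-θ)) := by
    have h1 : a ^ q = κ * J / M := by rw [hM]; field_simp
    have h2 : a ^ q = a ^ 2 * (a ^ q) ^ θ := by
      rw [← Real.rpow_mul ha0.le, ← Real.rpow_natCast, ← Real.rpow_add ha0]
      congr 1
      rw [hθ]
      field_simp
      push_cast
      ring
    rw [← Real.mul_rpow hκ0.le hJ.le, Real.rpow_neg hM0.le, ← div_eq_mul_inv,
      ← Real.div_rpow (by positivity) hM0.le, ← h1]
    exact h2
  have hfx : f x ^ 2 = a ^ 2 := by rw [ha, sq_abs]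
  rcases le_or_gt M 1 with hM1 | hM1
  · -- The radius `M ^ (1 / N)` makes the volume of the ball equal to `M * β`.
    set r : ℝ := M ^ (1 / (N : ℝ)) with hr
    have hr0 : 0 < r := by positivity
    have hrN : r ^ N = M := by
      rw [hr, ← Real.rpow_natCast, ← Real.rpow_mul hM0.le, one_div_mul_cancel hN.ne',
        Real.rpow_one]
    have hball : volume (Metric.ball x r) = ENNReal.ofReal (M * β) := by
      rw [Measure.addHaar_ball _ _ hr0.le, finrank_euclideanSpace, Fintype.card_fin, hrN,
        ENNReal.ofReal_mul hM0.le, hβ, ENNReal.ofReal_toReal measure_ball_lt_top.ne]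
    have hcheb : volume {y | a / 2 ≤ |f y|} ≤ ENNReal.ofReal (M * β / 2) := by
      have h1 := mul_meas_ge_le_lintegral₀ (μ := volume)
        (f := fun y => ENNReal.ofReal (|f y| ^ q)) (by fun_prop) (ENNReal.ofReal ((a / 2) ^ q))
      rw [hfJ] at h1
      have h2 : volume {y | a / 2 ≤ |f y|} ≤
          volume {y | ENNReal.ofReal ((a / 2) ^ q) ≤ ENNReal.ofReal (|f y| ^ q)} := by
        refine measure_mono fun y hy => ?_
        exact ENNReal.ofReal_le_ofReal (Real.rpow_le_rpow (by positivity) hy (by linarith))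
      have h3 : M * β / 2 = J / (a / 2) ^ q := by
        rw [hM, hκ, Real.rpow_add two_pos, Real.rpow_one, Real.div_rpow ha0.le two_pos.le]
        field_simp
      rw [h3, ENNReal.ofReal_div_of_pos (by positivity)]
      rw [ENNReal.le_div_iff_mul_le (Or.inl (by simp; positivity)) (Or.inl ENNReal.ofReal_ne_top),
        mul_comm]
      exact (mul_le_mul_right h2 _).trans h1
    set S := Metric.ball x r \ {y | a / 2 ≤ |f y|} with hS
    have hSm : MeasurableSet S :=
      measurableSet_ball.diff (measurableSet_le measurable_const (by fun_prop))
    have hSvol : ENNReal.ofReal (M * β / 2) ≤ volume S := by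
      refine le_trans ?_ le_measure_sdiff
      rw [hball]
      refine le_trans ?_ (tsub_le_tsub_left hcheb _)
      rw [← ENNReal.ofReal_sub _ (by positivity)]
      exact ENNReal.ofReal_le_ofReal (by linarith)
    have hpt : ∀ y ∈ S, ENNReal.ofReal (a ^ 2 / 4 * M ^ (-(1 + 2 * s / N))) ≤
        ENNReal.ofReal (diffQuot s f (x, y) ^ 2) := by
      rintro y ⟨hy1, hy2⟩
      refine ENNReal.ofReal_le_ofReal ?_
      simp only [Set.mem_ofPred_eq, not_le] at hy2
      rw [Metric.mem_ball, dist_comm, dist_eq_norm] at hy1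
      have hxy : x ≠ y := by
        rintro rfl
        linarith
      have hn : 0 < ‖x - y‖ := norm_pos_iff.2 (sub_ne_zero.2 hxy)
      rw [sq (diffQuot s f (x, y)), diffQuot_mul hs, ← sq]
      have h1 : a ^ 2 / 4 ≤ (f x - f y) ^ 2 := by
        have h2 : a / 2 ≤ |f x - f y| := by
          have := abs_sub_abs_le_abs_sub (f x) (f y)
          linarith
        rw [← sq_abs (f x - f y)]
        nlinarith
      have h2 : ‖x - y‖ ^ ((N : ℝ) + 2 * s) ≤ M ^ (1 + 2 * s / N) := by
        have h3 : M ^ (1 + 2 * s / N) = r ^ ((N : ℝ) + 2 * s) := by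
          rw [hr, ← Real.rpow_mul hM0.le]
          congr 1
          field_simp
        rw [h3]
        exact Real.rpow_le_rpow hn.le hy1.le (by positivity)
      rw [Real.rpow_neg hM0.le, ← div_eq_mul_inv]
      gcongr
    have hD : ENNReal.ofReal (a ^ 2 * β / 8 * M ^ (-θ)) ≤
        ∫⁻ y, ENNReal.ofReal (diffQuot s f (x, y) ^ 2) := by
      calc ENNReal.ofReal (a ^ 2 * β / 8 * M ^ (-θ))
          ≤ ENNReal.ofReal (a ^ 2 / 4 * M ^ (-(1 + 2 * s / N)) * (M * β / 2)) := by
            refine ENNReal.ofReal_le_ofReal ?_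
            have h1 : M ^ (-(1 + 2 * s / N)) * M = M ^ (-(2 * s / N)) := by
              nth_rewrite 2 [← Real.rpow_one M]
              rw [← Real.rpow_add hM0]
              congr 1
              ring
            have h2 : M ^ (-θ) ≤ M ^ (-(2 * s / N)) :=
              Real.rpow_le_rpow_of_exponent_ge hM0 hM1 (by linarith)
            calc a ^ 2 * β / 8 * M ^ (-θ) ≤ a ^ 2 * β / 8 * M ^ (-(2 * s / N)) := by gcongr
              _ = _ := by rw [← h1]; ring
        _ ≤ ENNReal.ofReal (a ^ 2 / 4 * M ^ (-(1 + 2 * s / N))) * volume S := by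
            rw [ENNReal.ofReal_mul (by positivity)]
            gcongr
        _ = ∫⁻ y in S, ENNReal.ofReal (a ^ 2 / 4 * M ^ (-(1 + 2 * s / N))) := by
            rw [setLIntegral_const]
        _ ≤ ∫⁻ y in S, ENNReal.ofReal (diffQuot s f (x, y) ^ 2) := setLIntegral_mono' hSm hpt
        _ ≤ _ := setLIntegral_le_lintegral _ _
    calc ENNReal.ofReal (a ^ q)
        = ENNReal.ofReal (8 / β * κ ^ θ * J ^ θ) *
            ENNReal.ofReal (a ^ 2 * β / 8 * M ^ (-θ)) := by
          rw [← ENNReal.ofReal_mul (by positivity), key]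
          congr 1
          field_simp
      _ ≤ ENNReal.ofReal ((8 / β + 1) * κ ^ θ * J ^ θ) *
            ((∫⁻ y, ENNReal.ofReal (diffQuot s f (x, y) ^ 2)) + ENNReal.ofReal (f x ^ 2)) := by
          gcongr
          · linarith
          · exact hD.trans (le_add_of_nonneg_right bot_le)
  · calc ENNReal.ofReal (a ^ q)
        ≤ ENNReal.ofReal (κ ^ θ * J ^ θ) * ENNReal.ofReal (a ^ 2) := by
          rw [← ENNReal.ofReal_mul (by positivity), key]
          refine ENNReal.ofReal_le_ofReal ?_
          have : M ^ (-θ) ≤ 1 := Real.rpow_le_one_of_one_le_of_nonpos hM1.le (by linarith)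
          have h0 : 0 ≤ a ^ 2 * (κ ^ θ * J ^ θ) := by positivity
          nlinarith
      _ ≤ _ := by
          rw [hfx]
          gcongr
          · have : 0 < 8 / β := by positivity
            have h0 : 0 < κ ^ θ := by positivity
            nlinarith
          · exact le_add_of_nonneg_left bot_le

/-- The square of the `H^s` norm: Gagliardo seminorm squared plus `L²` norm squared. -/
def normSqHs (s : ℝ) (f : Space N → ℝ) : ℝ :=
  (∫ z, diffQuot s f z ^ 2) + ∫ x, f x ^ 2

lemma normSqHs_nonneg (f : Space N → ℝ) : 0 ≤ normSqHs s f :=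
  add_nonneg (integral_nonneg fun _ => sq_nonneg _) (integral_nonneg fun _ => sq_nonneg _)

lemma lintegral_local_energy {f : Space N → ℝ} (hf : MemHs s f) :
    ∫⁻ x, ((∫⁻ y, ENNReal.ofReal (diffQuot s f (x, y) ^ 2)) + ENNReal.ofReal (f x ^ 2)) =
      ENNReal.ofReal (normSqHs s f) := by
  have h1 : AEMeasurable (fun z => ENNReal.ofReal (diffQuot s f z ^ 2))
      ((volume : Measure (Space N)).prod volume) :=
    ((aestronglyMeasurable_diffQuot hf.1.1).aemeasurable.pow_const 2).ennreal_ofReal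
  rw [lintegral_add_left' h1.lintegral_prod_right', ← lintegral_prod _ h1, normSqHs,
    ENNReal.ofReal_add (integral_nonneg fun _ => sq_nonneg _)
      (integral_nonneg fun _ => sq_nonneg _),
    ofReal_integral_eq_lintegral_ofReal hf.memLp_diffQuot.integrable_sq
      (Filter.Eventually.of_forall fun _ => sq_nonneg _),
    ofReal_integral_eq_lintegral_ofReal hf.1.integrable_sq
      (Filter.Eventually.of_forall fun _ => sq_nonneg _)]
  rfl

/-- The Sobolev inequality for functions already known to lie in `L^q`. -/
lemma sobolev_of_lintegral_ne_top [NeZero N] (hs : 0 < s) (hq : 2 < q)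
    (hcrit : N * (q - 2) ≤ 2 * s * q) :
    ∃ C : ℝ, 0 < C ∧ ∀ f : Space N → ℝ, Measurable f → MemHs s f →
      ∫⁻ x, ENNReal.ofReal (|f x| ^ q) ≠ ⊤ →
      ∫⁻ x, ENNReal.ofReal (|f x| ^ q) ≤ ENNReal.ofReal ((C * normSqHs s f) ^ (q / 2)) := by
  obtain ⟨C, hC, h⟩ := rpow_le_local_energy (N := N) hs hq hcrit
  refine ⟨C, hC, fun f hfm hf hfin => ?_⟩
  obtain ⟨J, hJ0, hJ'⟩ : ∃ J : ℝ, 0 ≤ J ∧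
      ∫⁻ x, ENNReal.ofReal (|f x| ^ q) = ENNReal.ofReal J :=
    ⟨_, ENNReal.toReal_nonneg, (ENNReal.ofReal_toReal hfin).symm⟩
  rcases hJ0.eq_or_lt with h0 | h0
  · rw [hJ', ← h0]
    simp
  have hQ := normSqHs_nonneg (s := s) f
  have h1 : ENNReal.ofReal J ≤ ENNReal.ofReal (C * J ^ (1 - 2 / q) * normSqHs s f) := by
    rw [← hJ', ENNReal.ofReal_mul (by positivity), ← lintegral_local_energy hf,
      ← lintegral_const_mul' _ _ ENNReal.ofReal_ne_top]
    exact lintegral_mono (h f J hfm h0 hJ')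
  rw [ENNReal.ofReal_le_ofReal_iff (by positivity)] at h1
  rw [hJ']
  refine ENNReal.ofReal_le_ofReal ?_
  have h2 : J ^ (2 / q) ≤ C * normSqHs s f := by
    have h3 : J = J ^ (1 - 2 / q) * J ^ (2 / q) := by
      rw [← Real.rpow_add h0]; simp
    have h4 : 0 < J ^ (1 - 2 / q) := by positivity
    refine le_of_mul_le_mul_left ?_ h4
    rw [← h3]
    linarith
  calc J = (J ^ (2 / q)) ^ (q / 2) := by
        rw [← Real.rpow_mul h0.le]
        field_simp
        simp
    _ ≤ _ := Real.rpow_le_rpow (by positivity) h2 (by linarith)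

/-- **Fractional Sobolev inequality**: `H^s(ℝ^N)` embeds into `L^q` as long as
`N (q - 2) ≤ 2 s q`, which is `q ≤ 2N / (N - 2s)` if `2s < N` and no restriction otherwise. -/
theorem sobolev [NeZero N] (hs : 0 < s) (hq : 2 < q) (hcrit : N * (q - 2) ≤ 2 * s * q) :
    ∃ C : ℝ, 0 < C ∧ ∀ f : Space N → ℝ, MemHs s f →
      Integrable (fun x => |f x| ^ q) ∧
      (∫ x, |f x| ^ q) ^ (2 / q) ≤ C * normSqHs s f := by
  obtain ⟨C, hC, h⟩ := sobolev_of_lintegral_ne_top (N := N) hs hq hcrit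
  have hmain : ∀ f : Space N → ℝ, Measurable f → MemHs s f →
      ∫⁻ x, ENNReal.ofReal (|f x| ^ q) ≤ ENNReal.ofReal ((C * normSqHs s f) ^ (q / 2)) := by
    intro f hfm hf
    -- Truncate `f` at height `n` and let `n → ∞`.
    set T : ℕ → Space N → ℝ := fun n x => max (-(n : ℝ)) (min (f x) n) with hT
    have hTm : ∀ n, Measurable (T n) := fun n => by fun_prop
    have habs : ∀ n x, |T n x| ≤ |f x| := fun n x => by
      have : (0 : ℝ) ≤ n := by positivity
      rw [abs_le]
      constructor
      · rcases le_total (f x) n with h | h <;> simp only [hT, min_eq_left h, min_eq_right h] <;>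
          rcases abs_cases (f x) with h2 | h2 <;> rw [le_max_iff] <;>
          (right; linarith)
      · refine max_le ?_ ((min_le_left _ _).trans (le_abs_self _))
        linarith [abs_nonneg (f x)]
    have hlip : ∀ n x y, |T n x - T n y| ≤ |f x - f y| := fun n x y => by
      refine (abs_max_sub_max_le_max _ _ _ _).trans ?_
      rw [sub_self, abs_zero, max_eq_right (abs_nonneg _)]
      refine (abs_min_sub_min_le_max _ _ _ _).trans ?_
      rw [sub_self, abs_zero, max_eq_left (abs_nonneg _)]
    have hTs : ∀ n, MemHs s (T n) := fun n =>
      hf.of_contraction (hTm n).aestronglyMeasurable (habs n) (hlip n)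
    have hbd : ∀ n x, |T n x| ≤ n := fun n x => by
      have : (0 : ℝ) ≤ n := by positivity
      rw [abs_le]
      exact ⟨le_max_left _ _, max_le (by linarith) (min_le_right _ _)⟩
    have hfin : ∀ n, ∫⁻ x, ENNReal.ofReal (|T n x| ^ q) ≠ ⊤ := fun n => by
      have h1 : Integrable (fun x => (n : ℝ) ^ (q - 2) * T n x ^ 2) :=
        (hTs n).1.integrable_sq.const_mul _
      refine ne_top_of_le_ne_top (h1.lintegral_lt_top).ne (lintegral_mono fun x => ?_)
      refine ENNReal.ofReal_le_ofReal ?_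
      rcases (abs_nonneg (T n x)).eq_or_lt with h0 | h0
      · rw [← h0, Real.zero_rpow (by linarith)]
        positivity
      · have : |T n x| ^ q = |T n x| ^ (q - 2) * T n x ^ 2 := by
          rw [← sq_abs (T n x), ← Real.rpow_natCast, ← Real.rpow_add h0]
          norm_num
        rw [this]
        exact mul_le_mul_of_nonneg_right (Real.rpow_le_rpow h0.le (hbd n x) (by linarith))
          (sq_nonneg _)
    have hQ : ∀ n, normSqHs s (T n) ≤ normSqHs s f := fun n => by
      refine add_le_add (integral_mono (hTs n).memLp_diffQuot.integrable_sq
        hf.memLp_diffQuot.integrable_sq fun z => ?_)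
        (integral_mono (hTs n).1.integrable_sq hf.1.integrable_sq fun x => ?_)
      · refine sq_le_sq.2 ?_
        simp only [diffQuot, abs_div]
        exact div_le_div_of_nonneg_right (hlip _ _ _) (abs_nonneg _)
      · exact sq_le_sq.2 (habs n x)
    have hbound : ∀ n, ∫⁻ x, ENNReal.ofReal (|T n x| ^ q) ≤
        ENNReal.ofReal ((C * normSqHs s f) ^ (q / 2)) := fun n => by
      refine (h _ (hTm n) (hTs n) (hfin n)).trans (ENNReal.ofReal_le_ofReal ?_)
      have := normSqHs_nonneg (s := s) (T n)
      refine Real.rpow_le_rpow (by positivity) ?_ (by linarith)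
      gcongr
      exact hQ n
    have hlim : ∀ x, Filter.liminf (fun n => ENNReal.ofReal (|T n x| ^ q)) Filter.atTop =
        ENNReal.ofReal (|f x| ^ q) := fun x => by
      refine Filter.Tendsto.liminf_eq (tendsto_const_nhds.congr' ?_)
      filter_upwards [Filter.eventually_ge_atTop ⌈|f x|⌉₊] with n hn
      have h1 : |f x| ≤ n := (Nat.le_ceil _).trans (by exact_mod_cast hn)
      have h2 := abs_le.1 h1
      simp only [hT, min_eq_left h2.2, max_eq_right h2.1]
    calc ∫⁻ x, ENNReal.ofReal (|f x| ^ q)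
        = ∫⁻ x, Filter.liminf (fun n => ENNReal.ofReal (|T n x| ^ q)) Filter.atTop := by
          simp only [hlim]
      _ ≤ Filter.liminf (fun n => ∫⁻ x, ENNReal.ofReal (|T n x| ^ q)) Filter.atTop :=
          lintegral_liminf_le fun n => by have := hTm n; fun_prop
      _ ≤ _ := Filter.liminf_le_of_le (by isBoundedDefault) fun b hb => by
          obtain ⟨n, hn⟩ := hb.exists
          exact hn.trans (hbound n)
  refine ⟨C, hC, fun f hf => ?_⟩
  have hg : f =ᵐ[volume] hf.1.1.mk f := hf.1.1.ae_eq_mk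
  set g := hf.1.1.mk f with hgdef
  have hgm : Measurable g := hf.1.1.stronglyMeasurable_mk.measurable
  have hgs : MemHs s g := hf.congr hg
  have hQ : normSqHs s g = normSqHs s f := by
    unfold normSqHs
    congr 1
    · refine integral_congr_ae ?_
      filter_upwards [diffQuot_congr (s := s) hg] with z hz
      rw [hz]
    · refine integral_congr_ae ?_
      filter_upwards [hg] with z hz
      rw [hz]
  have hgi : Integrable (fun x => |g x| ^ q) := by
    have hm : Measurable fun x => |g x| ^ q := by fun_prop
    refine ⟨hm.aestronglyMeasurable, ?_⟩
    rw [hasFiniteIntegral_iff_ofReal (Filter.Eventually.of_forall fun x => by positivity)]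
    exact (hmain g hgm hgs).trans_lt ENNReal.ofReal_lt_top
  have hfg : (fun x => |g x| ^ q) =ᵐ[volume] fun x => |f x| ^ q := by
    filter_upwards [hg] with x hx
    rw [hx]
  refine ⟨hgi.congr hfg, ?_⟩
  rw [← integral_congr_ae hfg, ← hQ]
  have hnn : 0 ≤ C * normSqHs s g := mul_nonneg hC.le (normSqHs_nonneg g)
  have h1 : ∫ x, |g x| ^ q ≤ (C * normSqHs s g) ^ (q / 2) := by
    have h2 := hmain g hgm hgs
    rw [← ofReal_integral_eq_lintegral_ofReal hgi
      (Filter.Eventually.of_forall fun x => by positivity)] at h2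
    exact (ENNReal.ofReal_le_ofReal_iff (by positivity)).1 h2
  calc (∫ x, |g x| ^ q) ^ (2 / q) ≤ ((C * normSqHs s g) ^ (q / 2)) ^ (2 / q) :=
        Real.rpow_le_rpow (integral_nonneg fun x => by positivity) h1 (by positivity)
    _ = C * normSqHs s g := by
        rw [← Real.rpow_mul hnn, div_mul_div_cancel₀ (by norm_num), div_self (by linarith),
          Real.rpow_one]

end

section

/-! ### Reflections in hyperplanes -/

variable {N : ℕ} [NeZero N] {s t : ℝ}

/-- The reflection `σ_t(x) = (2t - x₁, x₂, …, x_N)` with respect to the hyperplane `{x₁ = t}`. -/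
def refl (t : ℝ) (x : Space N) : Space N :=
  WithLp.toLp 2 (fun i => if i = 0 then 2 * t - x i else x i)

@[simp] lemma refl_zero (x : Space N) : refl t x 0 = 2 * t - x 0 := by simp [refl]

lemma refl_of_ne (x : Space N) {i : Fin N} (hi : i ≠ 0) : refl t x i = x i := by simp [refl, hi]

lemma reflection_eq (x : Space N) : reflection x = refl 0 x := by
  ext i
  simp [refl, reflection]

@[simp] lemma refl_refl (x : Space N) : refl t (refl t x) = x := by
  ext i
  by_cases hi : i = 0
  · subst hi; simp
  · simp [refl_of_ne _ hi]

lemma refl_eq_self {x : Space N} (hx : x 0 = t) : refl t x = x := by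
  ext i
  by_cases hi : i = 0
  · subst hi; simp; linarith
  · simp [refl_of_ne _ hi]

lemma refl_eq_refl_zero_add (x : Space N) :
    refl t x = refl 0 x + EuclideanSpace.single 0 (2 * t) := by
  ext i
  by_cases hi : i = 0
  · subst hi; simp; ring
  · simp [refl_of_ne _ hi, hi]

lemma norm_sub_refl_sq (x y : Space N) :
    ‖x - refl t y‖ ^ 2 = ‖x - y‖ ^ 2 + 4 * (x 0 - t) * (y 0 - t) := by
  rw [EuclideanSpace.real_norm_sq_eq, EuclideanSpace.real_norm_sq_eq,
    ← Finset.add_sum_erase _ _ (Finset.mem_univ (0 : Fin N)),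
    ← Finset.add_sum_erase (a := (0 : Fin N)) _ (fun i => (x - y) i ^ 2) (Finset.mem_univ _),
    Finset.sum_congr rfl (g := fun i => (x - y) i ^ 2) fun i hi => by
      simp [refl_of_ne _ (Finset.ne_of_mem_erase hi)]]
  simp
  ring

lemma norm_refl_sub_refl (x y : Space N) : ‖refl t x - refl t y‖ = ‖x - y‖ := by
  rw [← sq_eq_sq₀ (norm_nonneg _) (norm_nonneg _), norm_sub_refl_sq, norm_sub_rev,
    norm_sub_refl_sq, norm_sub_rev, refl_zero]
  ring

lemma norm_refl_sub (x y : Space N) : ‖refl t x - y‖ = ‖x - refl t y‖ := by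
  rw [← norm_refl_sub_refl, refl_refl]

lemma measurePreserving_refl : MeasurePreserving (refl (N := N) t) := by
  have h0 : ∀ x : Space N, refl 0 x = WithLp.toLp 2 (fun i => if i = 0 then -x i else x i) :=
    fun x => by ext i; simp [refl]
  let L : Space N ≃ₗᵢ[ℝ] Space N :=
    { toFun := refl 0
      invFun := refl 0
      map_add' := fun x y => by
        ext i
        by_cases hi : i = 0
        · subst hi; simp; ring
        · simp [refl_of_ne _ hi]
      map_smul' := fun c x => by
        ext i
        by_cases hi : i = 0
        · subst hi; simp
        · simp [refl_of_ne _ hi]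
      left_inv := refl_refl
      right_inv := refl_refl
      norm_map' := fun x => by
        have h : refl 0 (0 : Space N) = 0 := by
          ext i
          by_cases hi : i = 0
          · subst hi; simp
          · simp [refl_of_ne _ hi]
        have := norm_refl_sub_refl (t := 0) x 0
        rw [h, sub_zero, sub_zero] at this
        exact this }
  have h1 := (measurePreserving_add_right volume (EuclideanSpace.single (0 : Fin N) (2 * t))).comp
    L.measurePreserving
  have h2 : refl t = (fun x => x + EuclideanSpace.single (0 : Fin N) (2 * t)) ∘ L :=
    funext refl_eq_refl_zero_add
  rw [h2]
  exact h1

lemma measurable_refl : Measurable (refl (N := N) t) := measurePreserving_refl.measurable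

lemma ae_refl {P : Space N → Prop} (h : ∀ᵐ x, P x) : ∀ᵐ x, P (refl t x) :=
  (measurePreserving_refl (t := t)).quasiMeasurePreserving.ae h

lemma measurableEmbedding_refl : MeasurableEmbedding (refl (N := N) t) :=
  (MeasurableEquiv.mk (Equiv.mk (refl t) (refl t) refl_refl refl_refl) measurable_refl
    measurable_refl).measurableEmbedding

lemma integral_comp_refl (f : Space N → ℝ) : ∫ x, f (refl t x) = ∫ x, f x :=
  measurePreserving_refl.integral_comp measurableEmbedding_refl f

lemma ae_ne_zero_coord (t : ℝ) : ∀ᵐ x : Space N, x 0 ≠ t := by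
  have h := (EuclideanSpace.volume_preserving_symm_measurableEquiv_toLp
    (Fin N)).quasiMeasurePreserving.ae (p := fun f : Fin N → ℝ => f 0 ≠ t) (by
      rw [ae_iff]
      simp only [ne_eq, not_not]
      exact Measure.pi_hyperplane _ _ _)
  exact h

/-! ### Folding integrals over a half-space -/

/-- The sum of `F` over the four pairs obtained from `(x, y)` by reflecting `x`, `y` or both with
respect to `{x₁ = t}`. -/
def fold (t : ℝ) (F : Space N × Space N → ℝ) (z : Space N × Space N) : ℝ :=
  F z + F (refl t z.1, refl t z.2) + F (z.1, refl t z.2) + F (refl t z.1, z.2)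

lemma measurePreserving_both :
    MeasurePreserving fun z : Space N × Space N => (refl t z.1, refl t z.2) :=
  measurePreserving_refl.prod measurePreserving_refl

lemma measurePreserving_right :
    MeasurePreserving fun z : Space N × Space N => (z.1, refl t z.2) :=
  (MeasurePreserving.id volume).prod measurePreserving_refl

lemma measurePreserving_left :
    MeasurePreserving fun z : Space N × Space N => (refl t z.1, z.2) :=
  measurePreserving_refl.prod (MeasurePreserving.id volume)

lemma integrable_fold {F : Space N × Space N → ℝ} (hF : Integrable F) :
    Integrable (fold t F) :=
  ((hF.add (measurePreserving_both.integrable_comp_of_integrable hF)).add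
    (measurePreserving_right.integrable_comp_of_integrable hF)).add
    (measurePreserving_left.integrable_comp_of_integrable hF)

omit [NeZero N] in
lemma integral_comp_of_measurePreserving {T : Space N × Space N → Space N × Space N}
    (hT : MeasurePreserving T) {F : Space N × Space N → ℝ} (hF : Integrable F) :
    ∫ z, F (T z) = ∫ z, F z := by
  rw [← integral_map hT.measurable.aemeasurable (by rw [hT.map_eq]; exact hF.1), hT.map_eq]

lemma integral_fold {F : Space N × Space N → ℝ} (hF : Integrable F) :
    ∫ z, fold t F z = 4 * ∫ z, F z := by
  have h1 := (measurePreserving_both (N := N) (t := t)).integrable_comp_of_integrable hF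
  have h2 := (measurePreserving_right (N := N) (t := t)).integrable_comp_of_integrable hF
  have h3 := (measurePreserving_left (N := N) (t := t)).integrable_comp_of_integrable hF
  have e1 := integral_comp_of_measurePreserving (measurePreserving_both (N := N) (t := t)) hF
  have e2 := integral_comp_of_measurePreserving (measurePreserving_right (N := N) (t := t)) hF
  have e3 := integral_comp_of_measurePreserving (measurePreserving_left (N := N) (t := t)) hF
  have : ∫ z, fold t F z = (∫ z, F z) + (∫ z : Space N × Space N, F (refl t z.1, refl t z.2)) +
      (∫ z : Space N × Space N, F (z.1, refl t z.2)) +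
      ∫ z : Space N × Space N, F (refl t z.1, z.2) := by
    refine (integral_add ((hF.add h1).add h2) h3).trans ?_
    congr 1
    refine (integral_add (hF.add h1) h2).trans ?_
    congr 1
    exact integral_add hF h1
  rw [this, e1, e2, e3]
  ring

/-- A property of pairs that is invariant under reflecting either point holds almost everywhere
as soon as it holds for almost all pairs of distinct points of the half-space `{x₁ > t}`. -/
lemma ae_of_ae_halfSpace {P : Space N × Space N → Prop}
    (hl : ∀ z, P (refl t z.1, z.2) → P z) (hr : ∀ z, P (z.1, refl t z.2) → P z)
    (h : ∀ᵐ z : Space N × Space N, t < z.1 0 → t < z.2 0 → z.1 ≠ z.2 → P z) :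
    ∀ᵐ z, P z := by
  have h0 : ∀ᵐ z : Space N × Space N, t < z.1 0 → t < z.2 0 → P z := by
    filter_upwards [h, ae_fst_ne_snd] with z h1 h2 h3 h4 using h1 h3 h4 h2
  have h1 := measurePreserving_both (N := N) (t := t) |>.quasiMeasurePreserving.ae h0
  have h2 := measurePreserving_left (N := N) (t := t) |>.quasiMeasurePreserving.ae h0
  have h3 := measurePreserving_right (N := N) (t := t) |>.quasiMeasurePreserving.ae h0
  filter_upwards [h0, h1, h2, h3, ae_fst (ae_ne_zero_coord t), ae_snd (ae_ne_zero_coord t)]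
    with z h0 h1 h2 h3 h4 h5
  simp only [refl_zero] at h1 h2 h3
  rcases h4.lt_or_gt with h4 | h4 <;> rcases h5.lt_or_gt with h5 | h5
  · exact hl _ (hr _ (h1 (by linarith) (by linarith)))
  · exact hl _ (h2 (by linarith) (by linarith))
  · exact hr _ (h3 (by linarith) (by linarith))
  · exact h0 (by linarith) (by linarith)

lemma fold_left (F : Space N × Space N → ℝ) (z) : fold t F (refl t z.1, z.2) = fold t F z := by
  simp only [fold, refl_refl]; ring

lemma fold_right (F : Space N × Space N → ℝ) (z) : fold t F (z.1, refl t z.2) = fold t F z := by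
  simp only [fold, refl_refl]; ring

lemma fold_le_ae {F G : Space N × Space N → ℝ}
    (h : ∀ᵐ z : Space N × Space N, t < z.1 0 → t < z.2 0 → z.1 ≠ z.2 →
      fold t F z ≤ fold t G z) : ∀ᵐ z, fold t F z ≤ fold t G z :=
  ae_of_ae_halfSpace (P := fun z => fold t F z ≤ fold t G z)
    (fun z hz => by simpa only [fold_left] using hz)
    (fun z hz => by simpa only [fold_right] using hz) h

lemma integral_le_of_fold_le {F G : Space N × Space N → ℝ} (hF : Integrable F)
    (hG : Integrable G)
    (h : ∀ᵐ z : Space N × Space N, t < z.1 0 → t < z.2 0 → z.1 ≠ z.2 →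
      fold t F z ≤ fold t G z) : ∫ z, F z ≤ ∫ z, G z := by
  have := integral_mono_ae (integrable_fold (t := t) hF) (integrable_fold hG) (fold_le_ae h)
  rw [integral_fold hF, integral_fold hG] at this
  linarith

lemma integrable_of_fold_le {F G : Space N × Space N → ℝ} (hF : AEStronglyMeasurable F)
    (hF0 : ∀ z, 0 ≤ F z) (hG : Integrable G)
    (h : ∀ᵐ z : Space N × Space N, t < z.1 0 → t < z.2 0 → z.1 ≠ z.2 →
      fold t F z ≤ fold t G z) : Integrable F := by
  refine (integrable_fold (t := t) hG).mono' hF ?_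
  filter_upwards [fold_le_ae h] with z hz
  rw [Real.norm_of_nonneg (hF0 z)]
  refine le_trans ?_ hz
  simp only [fold]
  linarith [hF0 (refl t z.1, refl t z.2), hF0 (z.1, refl t z.2), hF0 (refl t z.1, z.2)]

/-- The kernel `|x - y|^{-(N + 2s)}` of the fractional Laplacian. -/
def kernel (s : ℝ) (x y : Space N) : ℝ := (‖x - y‖ ^ ((N : ℝ) + 2 * s))⁻¹

omit [NeZero N] in
lemma kernel_nonneg (x y : Space N) : 0 ≤ kernel s x y := by
  unfold kernel; positivity

omit [NeZero N] in
lemma kernel_pos {x y : Space N} (h : x ≠ y) : 0 < kernel s x y := by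
  have : 0 < ‖x - y‖ := norm_pos_iff.2 (sub_ne_zero.2 h)
  unfold kernel
  positivity

/-- Two points of the same half-space interact more strongly than each of them with the mirror
image of the other. -/
lemma kernel_refl_lt (hs : 0 < s) {x y : Space N} (hx : t < x 0) (hy : t < y 0) (hxy : x ≠ y) :
    kernel s x (refl t y) < kernel s x y := by
  have h0 : 0 < ‖x - y‖ := norm_pos_iff.2 (sub_ne_zero.2 hxy)
  have h1 : ‖x - y‖ < ‖x - refl t y‖ := by
    rw [← sq_lt_sq₀ (norm_nonneg _) (norm_nonneg _), norm_sub_refl_sq]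
    have := mul_pos (sub_pos.2 hx) (sub_pos.2 hy)
    linarith
  unfold kernel
  refine inv_strictAnti₀ (by positivity) (Real.rpow_lt_rpow h0.le h1 (by positivity))

omit [NeZero N] in
lemma diffQuot_mul_eq_kernel (hs : 0 < s) (w v : Space N → ℝ) (z : Space N × Space N) :
    diffQuot s w z * diffQuot s v z =
      kernel s z.1 z.2 * ((w z.1 - w z.2) * (v z.1 - v z.2)) := by
  rw [diffQuot_mul hs, kernel]
  ring

lemma fold_diffQuot_mul (hs : 0 < s) (w v : Space N → ℝ) (z : Space N × Space N) :
    fold t (fun z => diffQuot s w z * diffQuot s v z) z =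
      kernel s z.1 z.2 * ((w z.1 - w z.2) * (v z.1 - v z.2) +
        (w (refl t z.1) - w (refl t z.2)) * (v (refl t z.1) - v (refl t z.2))) +
      kernel s z.1 (refl t z.2) * ((w z.1 - w (refl t z.2)) * (v z.1 - v (refl t z.2)) +
        (w (refl t z.1) - w z.2) * (v (refl t z.1) - v z.2)) := by
  simp only [fold, diffQuot_mul_eq_kernel hs]
  simp only [kernel, norm_refl_sub, refl_refl]
  ring

lemma MemHs.comp_refl {w : Space N → ℝ} (hw : MemHs s w) (t : ℝ) :
    MemHs s (fun x => w (refl t x)) := by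
  refine memHs_iff.2 ⟨hw.1.comp_measurePreserving measurePreserving_refl, ?_⟩
  have h := hw.memLp_diffQuot.comp_measurePreserving (measurePreserving_both (N := N) (t := t))
  refine h.ae_eq (Filter.Eventually.of_forall fun z => ?_)
  simp [diffQuot, norm_refl_sub_refl]

lemma energy_comp_refl (hs : 0 < s) {w v : Space N → ℝ} (hw : MemHs s w) (hv : MemHs s v) :
    energy s (fun x => w (refl t x)) (fun x => v (refl t x)) = energy s w v := by
  rw [energy_eq hs, energy_eq hs, ← integral_comp_of_measurePreserving
    (measurePreserving_both (N := N) (t := t)) (hw.integrable_diffQuot_mul hv)]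
  simp [diffQuot, norm_refl_sub_refl]

/-- Membership in `H^s` follows from a comparison of folded Gagliardo energies. -/
lemma memHs_of_fold_le {f w : Space N → ℝ} (hw : MemHs s w) (hf : MemLp f 2)
    {C : ℝ} (h : ∀ᵐ z : Space N × Space N, t < z.1 0 → t < z.2 0 → z.1 ≠ z.2 →
      fold t (fun z => diffQuot s f z * diffQuot s f z) z ≤
        C * fold t (fun z => diffQuot s w z * diffQuot s w z) z) : MemHs s f := by
  have hm := aestronglyMeasurable_diffQuot (s := s) hf.1
  refine memHs_iff.2 ⟨hf, (memLp_two_iff_integrable_sq hm).2 ?_⟩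
  have := integrable_of_fold_le (t := t) (hm.mul hm) (fun z => mul_self_nonneg _)
    ((hw.integrable_diffQuot_mul hw).const_mul C) (by
      filter_upwards [h] with z hz h1 h2 h3
      refine (hz h1 h2 h3).trans (le_of_eq ?_)
      simp only [fold]; ring)
  exact this.congr (Filter.Eventually.of_forall fun z => (sq _).symm)

/-- If `w ∈ H^s` is odd with respect to `{x₁ = t}`, its positive part on the half-space
`{x₁ > t}`, extended by zero, is still in `H^s`, although a cut-off at a hyperplane need not
preserve `H^s`. -/
lemma MemHs.oddPosPart (hs : 0 < s) {w : Space N → ℝ} (hw : MemHs s w)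
    (hodd : ∀ x, w (refl t x) = -w x) :
    MemHs s (fun x => if t < x 0 then max (w x) 0 else 0) := by
  have hset : MeasurableSet {x : Space N | t < x 0} :=
    measurableSet_lt measurable_const (by fun_prop)
  have hm : AEStronglyMeasurable (fun x : Space N => if t < x 0 then max (w x) 0 else 0) := by
    have := (hw.1.1.sup aestronglyMeasurable_zero).indicator hset
    refine this.congr (Filter.Eventually.of_forall fun x => ?_)
    simp [Set.indicator]
  refine memHs_of_fold_le (t := t) (C := 2) hw (hw.1.of_le hm (Filter.Eventually.of_forall
    fun x => ?_)) (Filter.Eventually.of_forall fun z h1 h2 h3 => ?_)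
  · rw [Real.norm_eq_abs, Real.norm_eq_abs]
    split_ifs
    · rw [abs_of_nonneg (le_max_right _ _)]
      exact max_le (le_abs_self _) (abs_nonneg _)
    · simp
  · have h1' : ¬ t < 2 * t - z.1 0 := by linarith
    have h2' : ¬ t < 2 * t - z.2 0 := by linarith
    have hj := kernel_nonneg (s := s) z.1 (refl t z.2)
    have hkj := (kernel_refl_lt hs h1 h2 h3).le
    simp only [fold_diffQuot_mul hs, refl_zero, h1, h2, h1', h2', hodd, if_true, if_false]
    generalize w z.1 = a, w z.2 = b, kernel s z.1 z.2 = k, kernel s z.1 (refl t z.2) = j at *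
    rcases le_total 0 a with ha | ha <;> rcases le_total 0 b with hb | hb <;>
      simp only [max_eq_left, max_eq_right, ha, hb]
    · nlinarith [mul_nonneg ha hb, sq_nonneg (a - b), mul_nonneg hj (mul_nonneg ha hb),
        mul_nonneg (hj.trans hkj) (sq_nonneg (a - b)), mul_nonneg hj (sq_nonneg a),
        mul_nonneg hj (sq_nonneg b)]
    · have h5 : a ^ 2 ≤ (a - b) ^ 2 := by nlinarith
      nlinarith [mul_le_mul_of_nonneg_left h5 (hj.trans hkj),
        mul_le_mul_of_nonneg_right hkj (sq_nonneg a), mul_nonneg hj (sq_nonneg (a + b)),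
        mul_nonneg (hj.trans hkj) (sq_nonneg (a - b))]
    · have h5 : b ^ 2 ≤ (a - b) ^ 2 := by nlinarith
      nlinarith [mul_le_mul_of_nonneg_left h5 (hj.trans hkj),
        mul_le_mul_of_nonneg_right hkj (sq_nonneg b), mul_nonneg hj (sq_nonneg (a + b)),
        mul_nonneg (hj.trans hkj) (sq_nonneg (a - b))]
    · nlinarith [mul_nonneg hj (sq_nonneg (a + b)),
        mul_nonneg (hj.trans hkj) (sq_nonneg (a - b))]

/-! ### Polarization -/

lemma polarization_eq (v : Space N → ℝ) (x : Space N) :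
    polarization v x = if 0 < x 0 then min (v x) (v (refl 0 x)) else max (v x) (v (refl 0 x)) := by
  rw [polarization, reflection_eq]
  rcases lt_trichotomy (x 0) 0 with h | h | h
  · simp [h.not_ge, h.le.not_gt]
  · simp [h, refl_eq_self]
  · simp [h, h.le]

lemma polarization_add_polarization_refl (v : Space N → ℝ) (x : Space N) :
    polarization v x + polarization v (refl 0 x) = v x + v (refl 0 x) := by
  simp only [polarization_eq, refl_zero, refl_refl, mul_zero, zero_sub]
  rcases lt_trichotomy (x 0) 0 with h | h | h
  · simp [h, h.le.not_gt, min_comm (v (refl 0 x))]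
  · simp [h, refl_eq_self]
  · simp [h, h.le.not_gt, max_comm (v (refl 0 x))]

lemma polarization_sq_add_polarization_refl_sq (v : Space N → ℝ) (x : Space N) :
    polarization v x ^ 2 + polarization v (refl 0 x) ^ 2 = v x ^ 2 + v (refl 0 x) ^ 2 := by
  simp only [polarization_eq, refl_zero, refl_refl, mul_zero, zero_sub]
  rcases lt_trichotomy (x 0) 0 with h | h | h
  · rcases le_total (v x) (v (refl 0 x)) with h' | h' <;> simp [h, h.le.not_gt, h', add_comm]
  · simp [h, refl_eq_self]
  · rcases le_total (v x) (v (refl 0 x)) with h' | h' <;> simp [h, h.le.not_gt, h', add_comm]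

/-- The polarization of `v` differs from the even part of `v` by half of the odd function that
equals `±|v - v ∘ σ|` on the two sides of the hyperplane. -/
lemma MemHs.polarization (hs : 0 < s) {v : Space N → ℝ} (hv : MemHs s v) :
    MemHs s (polarization v) := by
  have hd : MemHs s (fun x => v x - v (refl 0 x)) := hv.sub (hv.comp_refl 0)
  have hd' : MemHs s (fun x => v (refl 0 x) - v x) := (hv.comp_refl 0).sub hv
  have hf := (hd.oddPosPart (t := 0) hs fun x => by rw [refl_refl]; ring).add
    (hd'.oddPosPart (t := 0) hs fun x => by rw [refl_refl]; ring)
  have := ((hv.add (hv.comp_refl 0)).sub (hf.sub (hf.comp_refl 0))).const_mul (1 / 2)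
  refine this.congr (Filter.Eventually.of_forall fun x => ?_)
  simp only [polarization_eq, refl_zero, refl_refl, mul_zero, zero_sub]
  rcases lt_trichotomy (x 0) 0 with h | h | h
  · rcases le_total (v x) (v (refl 0 x)) with h' | h' <;> simp [h, h.le.not_gt, h'] <;> ring
  · simp [h, refl_eq_self]
    ring
  · rcases le_total (v x) (v (refl 0 x)) with h' | h' <;> simp [h, h.le.not_gt, h'] <;> ring

/-- Polarization does not increase the energy. -/
lemma energy_polarization_le (hs : 0 < s) (hs1 : s < 1) {v : Space N → ℝ} (hv : MemHs s v) :
    energy s (polarization v) (polarization v) ≤ energy s v v := by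
  have hP := hv.polarization hs
  have hc := normConst_pos (N := N) hs hs1
  rw [energy_eq hs, energy_eq hs]
  refine mul_le_mul_of_nonneg_left (integral_le_of_fold_le (t := 0)
    (hP.integrable_diffQuot_mul hP) (hv.integrable_diffQuot_mul hv)
    (Filter.Eventually.of_forall fun z h1 h2 h3 => ?_)) (by positivity)
  have hkj := (kernel_refl_lt hs h1 h2 h3).le
  simp only [fold_diffQuot_mul hs, polarization_eq, refl_zero, refl_refl, mul_zero, zero_sub,
    h1, h2, Left.neg_pos_iff, h1.le.not_gt, h2.le.not_gt, if_true, if_false]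
  generalize v z.1 = a, v z.2 = b, v (refl 0 z.1) = a', v (refl 0 z.2) = b',
    kernel s z.1 z.2 = k, kernel s z.1 (refl 0 z.2) = j at *
  rcases le_total a a' with ha | ha <;> rcases le_total b b' with hb | hb <;>
    simp only [max_eq_left, max_eq_right, min_eq_left, min_eq_right, ha, hb] <;>
    nlinarith [mul_nonneg (sub_nonneg.2 hkj) (mul_nonneg (sub_nonneg.2 ha) (sub_nonneg.2 hb))]

end

section

/-! ### The linearized quadratic form -/

variable {N : ℕ} {s p lam μ : ℝ} {Ω : Set (Space N)} {u : Space N → ℝ}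

/-- The standing hypotheses on the exponents, with the upper bound on `p` written as the condition
of the Sobolev inequality for `L^{p+1}`. In this form it also covers `2s ≥ N`, where it follows
from `p > 1`. -/
structure Exponents (N : ℕ) (s p : ℝ) : Prop where
  s_pos : 0 < s
  s_lt_one : s < 1
  one_lt : 1 < p
  subcritical : N * (p + 1 - 2) ≤ 2 * s * (p + 1)

lemma Exponents.of_le (hs0 : 0 < s) (hs1 : s < 1) (hp : 1 < p)
    (hp_crit : 2 * s < N → p ≤ 2 * N / (N - 2 * s) - 1) : Exponents N s p := by
  refine ⟨hs0, hs1, hp, ?_⟩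
  rcases lt_or_ge (2 * s) N with h | h
  · have h1 := hp_crit h
    rw [le_sub_iff_add_le, le_div_iff₀ (by linarith)] at h1
    linarith
  · nlinarith

section Integrability

variable [NeZero N]

lemma MemHs.integrable_rpow (hE : Exponents N s p) {f : Space N → ℝ} (hf : MemHs s f) :
    Integrable (fun x => |f x| ^ (p + 1)) := by
  obtain ⟨C, -, h⟩ := sobolev (N := N) (q := p + 1) hE.s_pos (by linarith [hE.one_lt])
    hE.subcritical
  exact (h f hf).1

omit [NeZero N] in
/-- Products with total exponent `p + 1` are integrable if the `(p + 1)`-th powers of the factors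
are, since each factor is at most the largest one. -/
lemma integrable_rpow_mul_mul (hp : 1 < p) {f g h : Space N → ℝ}
    (hfm : AEStronglyMeasurable f) (hgm : AEStronglyMeasurable g) (hhm : AEStronglyMeasurable h)
    (hf : Integrable fun x => |f x| ^ (p + 1)) (hg : Integrable fun x => |g x| ^ (p + 1))
    (hh : Integrable fun x => |h x| ^ (p + 1)) :
    Integrable fun x => |f x| ^ (p - 1) * g x * h x := by
  refine ((hf.add hg).add hh).mono' ?_ (Filter.Eventually.of_forall fun x => ?_)
  · exact (((hfm.norm.aemeasurable.pow_const (p - 1)).aestronglyMeasurable.mul hgm).mul hhm)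
  · rw [Real.norm_eq_abs, abs_mul, abs_mul, abs_of_nonneg (a := |f x| ^ (p - 1)) (by positivity)]
    simp only [Pi.add_apply]
    set a := |f x|
    set b := |g x|
    set c := |h x|
    have ha : 0 ≤ a := abs_nonneg _
    have hb : 0 ≤ b := abs_nonneg _
    have hc : 0 ≤ c := abs_nonneg _
    set m := max a (max b c) with hm
    have hm0 : 0 ≤ m := ha.trans (le_max_left _ _)
    have h1 : a ^ (p - 1) * b * c ≤ m ^ (p + 1) := by
      rcases hm0.eq_or_lt with h0 | h0
      · have : b = 0 := le_antisymm (h0 ▸ (le_max_left _ _).trans (le_max_right _ _)) hb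
        rw [this, mul_zero, zero_mul]
        positivity
      · have h2 : m ^ (p + 1) = m ^ (p - 1) * m * m := by
          nth_rewrite 3 4 [← Real.rpow_one m]
          rw [← Real.rpow_add h0, ← Real.rpow_add h0]
          congr 1; ring
        rw [h2]
        gcongr
        · exact le_max_left _ _
        · exact (le_max_left _ _).trans (le_max_right _ _)
        · exact (le_max_right _ _).trans (le_max_right _ _)
    refine h1.trans ?_
    have e1 : 0 ≤ a ^ (p + 1) := by positivity
    have e2 : 0 ≤ b ^ (p + 1) := by positivity
    have e3 : 0 ≤ c ^ (p + 1) := by positivity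
    rcases max_choice a (max b c) with h | h
    · rw [hm, h]; linarith
    · rcases max_choice b c with h' | h' <;> rw [hm, h, h'] <;> linarith

lemma MemHs.integrable_rpow_mul_mul (hE : Exponents N s p) {f g h : Space N → ℝ}
    (hf : MemHs s f) (hg : MemHs s g) (hh : MemHs s h) :
    Integrable fun x => |f x| ^ (p - 1) * g x * h x :=
  FractionalDirichlet.integrable_rpow_mul_mul hE.one_lt hf.1.1 hg.1.1 hh.1.1
    (hf.integrable_rpow hE) (hg.integrable_rpow hE) (hh.integrable_rpow hE)

lemma MemHs.integrable_potential (hE : Exponents N s p) {f g h : Space N → ℝ}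
    (hf : MemHs s f) (hg : MemHs s g) (hh : MemHs s h) :
    Integrable fun x => p * |f x| ^ (p - 1) * g x * h x := by
  simpa only [mul_assoc] using (hf.integrable_rpow_mul_mul hE hg hh).const_mul p

end Integrability

section LinForm

lemma linForm_comm (φ ψ : Space N → ℝ) : linForm Ω s lam p u φ ψ = linForm Ω s lam p u ψ φ := by
  unfold linForm
  rw [energy_comm]
  have h1 : ∀ x, p * |u x| ^ (p - 1) * φ x * ψ x = p * |u x| ^ (p - 1) * ψ x * φ x :=
    fun x => by ring
  simp only [h1, mul_comm (φ _) (ψ _)]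

variable [NeZero N]

lemma linForm_add_left (hE : Exponents N s p) (hu : MemHs s u) {φ φ' ψ : Space N → ℝ}
    (hφ : MemHs s φ) (hφ' : MemHs s φ') (hψ : MemHs s ψ) :
    linForm Ω s lam p u (fun x => φ x + φ' x) ψ =
      linForm Ω s lam p u φ ψ + linForm Ω s lam p u φ' ψ := by
  unfold linForm
  simp only [mul_add, add_mul]
  rw [energy_add_left hE.s_pos hφ hφ' hψ,
    integral_add (hφ.integrable_mul hψ).integrableOn (hφ'.integrable_mul hψ).integrableOn,
    integral_add (hu.integrable_potential hE hφ hψ).integrableOn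
      (hu.integrable_potential hE hφ' hψ).integrableOn]
  ring

omit [NeZero N] in
lemma linForm_mul_left (hs : 0 < s) (c : ℝ) (φ ψ : Space N → ℝ) :
    linForm Ω s lam p u (fun x => c * φ x) ψ = c * linForm Ω s lam p u φ ψ := by
  unfold linForm
  have h1 : ∀ x, p * |u x| ^ (p - 1) * (c * φ x) * ψ x =
    c * (p * |u x| ^ (p - 1) * φ x * ψ x) := fun x => by ring
  simp only [h1, mul_assoc c]
  rw [energy_mul_left hs, integral_const_mul, integral_const_mul]
  ring

lemma linForm_sub_left (hE : Exponents N s p) (hu : MemHs s u) {φ φ' ψ : Space N → ℝ}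
    (hφ : MemHs s φ) (hφ' : MemHs s φ') (hψ : MemHs s ψ) :
    linForm Ω s lam p u (fun x => φ x - φ' x) ψ =
      linForm Ω s lam p u φ ψ - linForm Ω s lam p u φ' ψ := by
  have h : (fun x => φ x - φ' x) = fun x => φ x + (-1) * φ' x := by funext x; ring
  rw [h, linForm_add_left hE hu hφ (hφ'.const_mul _) hψ, linForm_mul_left hE.s_pos]
  ring

omit [NeZero N] in
lemma eq_zero_of_quadratic_nonneg {a b : ℝ} (h : ∀ c : ℝ, 0 ≤ 2 * c * b + c ^ 2 * a) : b = 0 := by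
  by_contra hb
  have ha : 0 < |a| + 1 := by positivity
  have h1 := h (-b / (|a| + 1))
  have h2 : 2 * (-b / (|a| + 1)) * b + (-b / (|a| + 1)) ^ 2 * a =
      b ^ 2 / (|a| + 1) * (a / (|a| + 1) - 2) := by
    field_simp
    ring
  rw [h2] at h1
  have h3 : a / (|a| + 1) - 2 < 0 := by
    rw [sub_neg, div_lt_iff₀ ha]
    linarith [le_abs_self a, abs_nonneg a]
  have h4 : 0 < b ^ 2 / (|a| + 1) := by positivity
  nlinarith

/-- Euler–Lagrange equation: a minimizer of the Rayleigh quotient on a linear space of admissible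
functions satisfies the eigenvalue equation against that space. -/
lemma weak_eq_of_minimizer (hE : Exponents N s p) (hu : MemHs s u)
    {X : (Space N → ℝ) → Prop} (hX : ∀ φ, X φ → MemHs s φ)
    (hadd : ∀ φ ψ, ∀ c : ℝ, X φ → X ψ → X (fun x => φ x + c * ψ x))
    (hmin : ∀ φ, X φ → μ * ∫ x in Ω, φ x * φ x ≤ linForm Ω s lam p u φ φ)
    {φ : Space N → ℝ} (hφ : X φ) (heq : linForm Ω s lam p u φ φ = μ * ∫ x in Ω, φ x * φ x)
    {ψ : Space N → ℝ} (hψ : X ψ) :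
    linForm Ω s lam p u φ ψ = μ * ∫ x in Ω, φ x * ψ x := by
  rw [← sub_eq_zero]
  refine eq_zero_of_quadratic_nonneg
    (a := linForm Ω s lam p u ψ ψ - μ * ∫ x in Ω, ψ x * ψ x) fun c => ?_
  have h := hmin _ (hadd φ ψ c hφ hψ)
  have hφ' := hX _ hφ
  have hψ' := hX _ hψ
  have hcψ := hψ'.const_mul c
  rw [linForm_add_left hE hu hφ' hcψ (hφ'.add hcψ), linForm_mul_left hE.s_pos,
    linForm_comm φ, linForm_comm ψ, linForm_add_left hE hu hφ' hcψ hφ',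
    linForm_add_left hE hu hφ' hcψ hψ', linForm_mul_left hE.s_pos, linForm_mul_left hE.s_pos,
    linForm_comm ψ φ, heq] at h
  have hint : ∫ x in Ω, (φ x + c * ψ x) * (φ x + c * ψ x) =
      (∫ x in Ω, φ x * φ x) + 2 * c * (∫ x in Ω, φ x * ψ x) + c ^ 2 * ∫ x in Ω, ψ x * ψ x := by
    have h1 : ∀ x, (φ x + c * ψ x) * (φ x + c * ψ x) =
        (φ x * φ x + 2 * c * (φ x * ψ x)) + c ^ 2 * (ψ x * ψ x) := fun x => by ring
    simp only [h1]
    have i1 := (hφ'.integrable_mul hφ').integrableOn (s := Ω)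
    have i2 := ((hφ'.integrable_mul hψ').const_mul (2 * c)).integrableOn (s := Ω)
    have i3 := ((hψ'.integrable_mul hψ').const_mul (c ^ 2)).integrableOn (s := Ω)
    refine (integral_add (i1.add i2) i3).trans ?_
    rw [integral_const_mul]
    congr 1
    refine (integral_add i1 i2).trans ?_
    rw [integral_const_mul]
  rw [hint] at h
  linarith

end LinForm

/-! ### First eigenfunctions have a sign -/

lemma ae_or_ae_of_mul_nonneg {φ : Space N → ℝ}
    (h : ∀ᵐ z : Space N × Space N, 0 ≤ φ z.1 * φ z.2) :
    (∀ᵐ x, 0 ≤ φ x) ∨ ∀ᵐ x, φ x ≤ 0 := by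
  have h1 : ∀ᵐ z : Space N × Space N, ¬ (φ z.1 < 0 ∧ 0 < φ z.2) := by
    filter_upwards [h] with z hz h1
    exact not_le.2 (mul_neg_of_neg_of_pos h1.1 h1.2) hz
  rcases ae_or_ae_of_prod (P := fun x => φ x < 0) (Q := fun x => 0 < φ x) h1 with h | h
  · exact Or.inl (h.mono fun x hx => not_lt.1 hx)
  · exact Or.inr (h.mono fun x hx => not_lt.1 hx)

/-- Passing to the absolute value strictly lowers the energy of a sign-changing function, because
each pair of points at which `φ` has opposite signs interacts. -/
lemma ae_or_ae_of_energy_le_abs [NeZero N] (hs : 0 < s) (hs1 : s < 1) {φ : Space N → ℝ}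
    (hφ : MemHs s φ) (h : energy s φ φ ≤ energy s (fun x => |φ x|) (fun x => |φ x|)) :
    (∀ᵐ x, 0 ≤ φ x) ∨ ∀ᵐ x, φ x ≤ 0 := by
  refine ae_or_ae_of_mul_nonneg ?_
  have hc := normConst_pos (N := N) hs hs1
  have i1 := hφ.integrable_diffQuot_mul hφ
  have i2 := hφ.abs.integrable_diffQuot_mul hφ.abs
  rw [energy_eq hs, energy_eq hs] at h
  have h1 := le_of_mul_le_mul_left h (by positivity)
  have hpt : ∀ z : Space N × Space N, diffQuot s φ z * diffQuot s φ z -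
      diffQuot s (fun x => |φ x|) z * diffQuot s (fun x => |φ x|) z =
      2 * kernel s z.1 z.2 * (|φ z.1 * φ z.2| - φ z.1 * φ z.2) := fun z => by
    rw [diffQuot_mul_eq_kernel hs, diffQuot_mul_eq_kernel hs, abs_mul]
    linear_combination (- kernel s z.1 z.2) * (abs_mul_abs_self (φ z.1) + abs_mul_abs_self (φ z.2))
  have hnn : 0 ≤ fun z : Space N × Space N =>
      2 * kernel s z.1 z.2 * (|φ z.1 * φ z.2| - φ z.1 * φ z.2) := fun z =>
    mul_nonneg (mul_nonneg two_pos.le (kernel_nonneg _ _)) (sub_nonneg.2 (le_abs_self _))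
  have h2 := integral_sub i1 i2
  have i3 := i1.sub i2
  simp only [hpt] at h2
  have h3 : Integrable fun z : Space N × Space N =>
      2 * kernel s z.1 z.2 * (|φ z.1 * φ z.2| - φ z.1 * φ z.2) :=
    i3.congr (Filter.Eventually.of_forall hpt)
  have h4 := (integral_eq_zero_iff_of_nonneg hnn h3).1
    (le_antisymm (by rw [h2]; linarith) (integral_nonneg hnn))
  filter_upwards [h4, ae_fst_ne_snd] with z hz hne
  have hk := kernel_pos (s := s) hne
  simp only [Pi.zero_apply, mul_eq_zero, OfNat.ofNat_ne_zero, hk.ne', false_or, or_self] at hz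
  rw [← sub_eq_zero.1 hz]
  exact abs_nonneg _

lemma MemHs0.setIntegral_mul_self_pos (hΩ : MeasurableSet Ω) {φ : Space N → ℝ}
    (hφ : MemHs0 Ω s φ) (h0 : ¬ φ =ᵐ[volume] 0) : 0 < ∫ x in Ω, φ x * φ x := by
  refine lt_of_le_of_ne (integral_nonneg fun _ => mul_self_nonneg _) fun h => h0 ?_
  have h1 := (integral_eq_zero_iff_of_nonneg (fun _ => mul_self_nonneg _)
    (hφ.1.integrable_mul hφ.1).integrableOn).1 h.symm
  rw [Filter.EventuallyEq, ae_restrict_iff' hΩ] at h1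
  filter_upwards [h1, hφ.2] with x h2 h3
  by_cases hx : x ∈ Ω
  · simpa using h2 hx
  · exact h3 hx

lemma linForm_of_ae_zero (hs : 0 < s) {φ : Space N → ℝ} (h0 : φ =ᵐ[volume] 0) :
    linForm Ω s lam p u φ φ = 0 ∧ ∫ x in Ω, φ x * φ x = 0 := by
  have h1 : ∫ x in Ω, φ x * φ x = 0 := integral_eq_zero_of_ae (by
    filter_upwards [ae_restrict_of_ae h0] with x hx
    simp [hx])
  have h2 : ∫ x in Ω, p * |u x| ^ (p - 1) * φ x * φ x = 0 := integral_eq_zero_of_ae (by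
    filter_upwards [ae_restrict_of_ae h0] with x hx
    simp [hx])
  have h3 : energy s φ φ = 0 := by
    rw [energy_congr hs h0 h0]
    simp [energy]
  simp [linForm, h1, h2, h3]

/-- Being the least Rayleigh quotient over the admissible functions in `X` amounts to an
inequality between quadratic forms. -/
lemma mul_le_linForm_of_lowerBound (hs : 0 < s) (hΩ : MeasurableSet Ω)
    {X : (Space N → ℝ) → Prop}
    (hμ : ∀ φ : Space N → ℝ, MemHs0 Ω s φ → ¬ φ =ᵐ[volume] 0 → X φ →
      μ ≤ linForm Ω s lam p u φ φ / ∫ x in Ω, φ x ^ 2)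
    {φ : Space N → ℝ} (hφ : MemHs0 Ω s φ) (hX : X φ) :
    μ * ∫ x in Ω, φ x * φ x ≤ linForm Ω s lam p u φ φ := by
  by_cases h0 : φ =ᵐ[volume] 0
  · have := linForm_of_ae_zero (Ω := Ω) (lam := lam) (p := p) (u := u) hs h0
    simp [this.1, this.2]
  · have := hμ φ hφ h0 hX
    simp only [sq] at this
    exact (le_div_iff₀ (hφ.setIntegral_mul_self_pos hΩ h0)).1 this

lemma IsFirstEigenvalue.mul_le (hμ : IsFirstEigenvalue Ω s lam p u μ) (hs : 0 < s)
    (hΩ : MeasurableSet Ω) {φ : Space N → ℝ} (hφ : MemHs0 Ω s φ) :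
    μ * ∫ x in Ω, φ x * φ x ≤ linForm Ω s lam p u φ φ :=
  mul_le_linForm_of_lowerBound (X := fun _ => True) hs hΩ
    (fun φ h1 h2 _ => hμ.2 ⟨φ, h1, h2, rfl⟩) hφ trivial

lemma IsFirstEigenvalue.ae_or_ae [NeZero N] (hE : Exponents N s p)
    (hΩ : MeasurableSet Ω) (hμ : IsFirstEigenvalue Ω s lam p u μ) {φ : Space N → ℝ}
    (hφ : MemHs0 Ω s φ) (heq : linForm Ω s lam p u φ φ = μ * ∫ x in Ω, φ x * φ x) :
    (∀ᵐ x, 0 ≤ φ x) ∨ ∀ᵐ x, φ x ≤ 0 := by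
  refine ae_or_ae_of_energy_le_abs hE.s_pos hE.s_lt_one hφ.1 ?_
  have h := hμ.mul_le hE.s_pos hΩ hφ.abs
  unfold linForm at h heq
  simp only [mul_assoc, abs_mul_abs_self] at h heq
  linarith

end

section

variable {N : ℕ} [NeZero N] {s p lam μ : ℝ} {Ω : Set (Space N)} {u : Space N → ℝ}

/-! ### The linearized problem at a symmetric function -/

lemma setIntegral_comp_refl (hΩs : ∀ x, refl 0 x ∈ Ω ↔ x ∈ Ω) (f : Space N → ℝ) :
    ∫ x in Ω, f (refl 0 x) = ∫ x in Ω, f x := by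
  have h := (measurePreserving_refl (N := N) (t := 0)).setIntegral_preimage_emb
    measurableEmbedding_refl f Ω
  rwa [show refl 0 ⁻¹' Ω = Ω from Set.ext hΩs] at h

lemma setIntegral_eq_of_add_refl_eq (hΩs : ∀ x, refl 0 x ∈ Ω ↔ x ∈ Ω) {f g : Space N → ℝ}
    (hf : Integrable f) (hg : Integrable g)
    (h : ∀ᵐ x, f x + f (refl 0 x) = g x + g (refl 0 x)) : ∫ x in Ω, f x = ∫ x in Ω, g x := by
  have hf' := (measurePreserving_refl (N := N) (t := 0)).integrable_comp_of_integrable hf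
  have hg' := (measurePreserving_refl (N := N) (t := 0)).integrable_comp_of_integrable hg
  have h1 : ∫ x in Ω, (f x + f (refl 0 x)) = (∫ x in Ω, f x) + ∫ x in Ω, f (refl 0 x) :=
    integral_add hf.integrableOn hf'.integrableOn
  have h2 : ∫ x in Ω, (g x + g (refl 0 x)) = (∫ x in Ω, g x) + ∫ x in Ω, g (refl 0 x) :=
    integral_add hg.integrableOn hg'.integrableOn
  have h3 := integral_congr_ae (μ := volume.restrict Ω) (ae_restrict_of_ae h)
  rw [setIntegral_comp_refl hΩs f] at h1
  rw [setIntegral_comp_refl hΩs g] at h2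
  linarith

lemma MemHs0.comp_refl (hΩs : ∀ x, refl 0 x ∈ Ω ↔ x ∈ Ω) {φ : Space N → ℝ}
    (hφ : MemHs0 Ω s φ) : MemHs0 Ω s (fun x => φ (refl 0 x)) := by
  refine ⟨hφ.1.comp_refl 0, ?_⟩
  filter_upwards [ae_refl (t := 0) hφ.2] with x hx h
  exact hx (by rwa [hΩs])

lemma MemHs0.polarization (hs : 0 < s) (hΩs : ∀ x, refl 0 x ∈ Ω ↔ x ∈ Ω) {φ : Space N → ℝ}
    (hφ : MemHs0 Ω s φ) : MemHs0 Ω s (polarization φ) := by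
  refine ⟨hφ.1.polarization hs, ?_⟩
  filter_upwards [hφ.2, ae_refl (t := 0) hφ.2] with x h1 h2 h3
  rw [polarization_eq, h1 h3, h2 (by rwa [hΩs])]
  simp

lemma linForm_comp_refl (hs : 0 < s) (hΩs : ∀ x, refl 0 x ∈ Ω ↔ x ∈ Ω)
    (hsym : ∀ᵐ x, u (refl 0 x) = u x) {φ ψ : Space N → ℝ} (hφ : MemHs s φ) (hψ : MemHs s ψ) :
    linForm Ω s lam p u (fun x => φ (refl 0 x)) (fun x => ψ (refl 0 x)) =
      linForm Ω s lam p u φ ψ := by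
  unfold linForm
  rw [energy_comp_refl hs hφ hψ, setIntegral_comp_refl hΩs (fun x => φ x * ψ x),
    ← setIntegral_comp_refl hΩs (fun x => p * |u x| ^ (p - 1) * φ x * ψ x)]
  congr 1
  refine integral_congr_ae (ae_restrict_of_ae ?_)
  filter_upwards [hsym] with x hx
  rw [hx]

/-- The difference of a first eigenfunction and its reflection is odd and, being zero or a first
eigenfunction, has a sign. -/
lemma IsFirstEigenvalue.ae_symmetric (hE : Exponents N s p) (hΩ : MeasurableSet Ω)
    (hΩs : ∀ x, refl 0 x ∈ Ω ↔ x ∈ Ω) (hu : MemHs s u) (hsym : ∀ᵐ x, u (refl 0 x) = u x)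
    (hμ : IsFirstEigenvalue Ω s lam p u μ) {φ : Space N → ℝ}
    (hφ : IsEigenfunction Ω s lam p u μ φ) : ∀ᵐ x, φ (refl 0 x) = φ x := by
  have hφ0 := hφ.mem
  have hφr := hφ0.comp_refl hΩs
  have hd := hφr.sub hφ0
  have heq : ∀ ψ, MemHs0 Ω s ψ → linForm Ω s lam p u (fun x => φ (refl 0 x)) ψ =
      μ * ∫ x in Ω, φ (refl 0 x) * ψ x := fun ψ hψ => by
    have h1 := hφ.weak_eq _ (hψ.comp_refl hΩs)
    rw [← linForm_comp_refl hE.s_pos hΩs hsym hφ0.1 (hψ.1.comp_refl 0),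
      ← setIntegral_comp_refl hΩs (fun x => φ x * ψ (refl 0 x))] at h1
    simpa only [refl_refl] using h1
  have hmin : linForm Ω s lam p u (fun x => φ (refl 0 x) - φ x) (fun x => φ (refl 0 x) - φ x) =
      μ * ∫ x in Ω, (φ (refl 0 x) - φ x) * (φ (refl 0 x) - φ x) := by
    rw [linForm_sub_left hE hu hφr.1 hφ0.1 hd.1, heq _ hd, hφ.weak_eq _ hd, ← mul_sub,
      ← integral_sub (hφr.1.integrable_mul hd.1).integrableOn
        (hφ0.1.integrable_mul hd.1).integrableOn]
    simp only [sub_mul]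
  rcases hμ.ae_or_ae hE hΩ hd hmin with h | h <;>
  · filter_upwards [h, ae_refl (t := 0) h] with x h1 h2
    rw [refl_refl] at h2
    linarith

/-- The first eigenvalue is simple: it is not attained on the orthogonal complement of a first
eigenfunction, since two functions with a sign are orthogonal only if their supports are
disjoint, and then their difference changes sign. -/
lemma IsFirstEigenvalue.not_orthogonal (hE : Exponents N s p) (hΩ : MeasurableSet Ω)
    (hu : MemHs s u) (hμ : IsFirstEigenvalue Ω s lam p u μ) {φ ψ : Space N → ℝ}
    (hφ : IsEigenfunction Ω s lam p u μ φ) (hψ : IsEigenfunction Ω s lam p u μ ψ) :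
    ∫ x in Ω, φ x * ψ x ≠ 0 := by
  intro horth
  have key : ∀ c : ℝ, (∀ᵐ x, 0 ≤ φ x - c * ψ x) ∨ ∀ᵐ x, φ x - c * ψ x ≤ 0 := fun c => by
    have hcψ := hψ.mem.const_mul c
    have hd := hφ.mem.sub hcψ
    refine hμ.ae_or_ae hE hΩ hd ?_
    rw [linForm_sub_left hE hu hφ.mem.1 hcψ.1 hd.1, linForm_mul_left hE.s_pos, hφ.weak_eq _ hd,
      hψ.weak_eq _ hd, mul_left_comm, ← integral_const_mul c, ← mul_sub,
      ← integral_sub (hφ.mem.1.integrable_mul hd.1).integrableOn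
        ((hψ.mem.1.integrable_mul hd.1).const_mul c).integrableOn]
    simp only [sub_mul, mul_assoc]
  have hsψ := hμ.ae_or_ae hE hΩ hψ.mem (hψ.weak_eq _ hψ.mem)
  have hsφ := hμ.ae_or_ae hE hΩ hφ.mem (hφ.weak_eq _ hφ.mem)
  have hprod : ∀ᵐ x, φ x * ψ x = 0 := by
    have hi := (hφ.mem.1.integrable_mul hψ.mem.1).integrableOn (s := Ω)
    have h1 : (fun x => φ x * ψ x) =ᵐ[volume.restrict Ω] 0 := by
      have hcases : (0 ≤ᵐ[volume.restrict Ω] fun x => φ x * ψ x) ∨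
          (0 ≤ᵐ[volume.restrict Ω] fun x => -(φ x * ψ x)) := by
        rcases hsφ with h1 | h1 <;> rcases hsψ with h2 | h2
        · left
          filter_upwards [ae_restrict_of_ae h1, ae_restrict_of_ae h2] with x h1 h2
          exact mul_nonneg h1 h2
        · right
          filter_upwards [ae_restrict_of_ae h1, ae_restrict_of_ae h2] with x h1 h2
          exact neg_nonneg.2 (mul_nonpos_of_nonneg_of_nonpos h1 h2)
        · right
          filter_upwards [ae_restrict_of_ae h1, ae_restrict_of_ae h2] with x h1 h2
          exact neg_nonneg.2 (mul_nonpos_of_nonpos_of_nonneg h1 h2)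
        · left
          filter_upwards [ae_restrict_of_ae h1, ae_restrict_of_ae h2] with x h1 h2
          exact mul_nonneg_of_nonpos_of_nonpos h1 h2
      rcases hcases with h | h
      · exact (integral_eq_zero_iff_of_nonneg_ae h hi).1 horth
      · have h2 := (integral_eq_zero_iff_of_nonneg_ae h hi.neg).1 (by
          rw [integral_neg, horth, neg_zero])
        filter_upwards [h2] with x hx
        simpa using hx
    rw [Filter.EventuallyEq, ae_restrict_iff' hΩ] at h1
    filter_upwards [h1, hφ.mem.2] with x h2 h3
    by_cases hx : x ∈ Ω
    · exact h2 hx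
    · rw [h3 hx, zero_mul]
  -- As `φ ψ = 0`, a sign of `φ - c ψ` is a sign of `φ` and of `-c ψ`. For `c = 1` and `c = -1`
  -- the signs obtained for `φ` or those obtained for `ψ` are opposite.
  rcases key 1 with h1 | h1 <;> rcases key (-1) with h2 | h2
  · refine hψ.ne_zero ?_
    filter_upwards [h1, h2, hprod] with x h1 h2 h3
    rcases mul_eq_zero.1 h3 with h3 | h3
    · exact le_antisymm (by simp only [Pi.zero_apply]; linarith)
        (by simp only [Pi.zero_apply]; linarith)
    · exact h3
  · refine hφ.ne_zero ?_
    filter_upwards [h1, h2, hprod] with x h1 h2 h3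
    rcases mul_eq_zero.1 h3 with h3 | h3
    · exact h3
    · exact le_antisymm (by simp only [Pi.zero_apply]; rw [h3] at h1 h2; linarith)
        (by simp only [Pi.zero_apply]; rw [h3] at h1 h2; linarith)
  · refine hφ.ne_zero ?_
    filter_upwards [h1, h2, hprod] with x h1 h2 h3
    rcases mul_eq_zero.1 h3 with h3 | h3
    · exact h3
    · exact le_antisymm (by simp only [Pi.zero_apply]; rw [h3] at h1 h2; linarith)
        (by simp only [Pi.zero_apply]; rw [h3] at h1 h2; linarith)
  · refine hψ.ne_zero ?_
    filter_upwards [h1, h2, hprod] with x h1 h2 h3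
    rcases mul_eq_zero.1 h3 with h3 | h3
    · exact le_antisymm (by simp only [Pi.zero_apply]; linarith)
        (by simp only [Pi.zero_apply]; linarith)
    · exact h3

/-- Polarization maps second eigenfunctions to second eigenfunctions if `u` is symmetric: it
does not increase the quadratic form, and it preserves the `L²` norm and the scalar product with
the first eigenfunction, which is symmetric. -/
theorem IsSecondEigenvalue.isEigenfunction_polarization (hE : Exponents N s p)
    (hΩ : MeasurableSet Ω) (hΩs : ∀ x, refl 0 x ∈ Ω ↔ x ∈ Ω) (hu : MemHs s u)
    (hsym : ∀ᵐ x, u (refl 0 x) = u x) (hμ : IsSecondEigenvalue Ω s lam p u μ)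
    {v : Space N → ℝ} (hv : IsEigenfunction Ω s lam p u μ v) :
    IsEigenfunction Ω s lam p u μ (polarization v) := by
  have hs := hE.s_pos
  obtain ⟨φ₁, ⟨μ₁, hμ₁, hφ₁⟩, ⟨φ₂, hφ₂, hφ₂0, hφ₂orth, hφ₂eq⟩, hlow⟩ := hμ
  have hφ₁sym := hμ₁.ae_symmetric hE hΩ hΩs hu hsym hφ₁
  have hne : μ ≠ μ₁ := by
    rintro rfl
    refine hμ₁.not_orthogonal hE hΩ hu hφ₁ ⟨hφ₂, hφ₂0, fun ψ hψ => ?_⟩ hφ₂orth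
    refine weak_eq_of_minimizer hE hu (X := MemHs0 Ω s) (fun _ h => h.1)
      (fun φ ψ c h h' => h.add (h'.const_mul c)) (fun φ h => hμ₁.mul_le hs hΩ h) hφ₂ ?_ hψ
    rw [hφ₂eq]
    simp only [sq]
    rw [div_mul_cancel₀ _ (hφ₂.setIntegral_mul_self_pos hΩ hφ₂0).ne']
  -- Eigenfunctions for different eigenvalues are orthogonal.
  have hvorth : ∫ x in Ω, φ₁ x * v x = 0 := by
    have h1 := hφ₁.weak_eq _ hv.mem
    have h2 := hv.weak_eq _ hφ₁.mem
    rw [linForm_comm, h1] at h2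
    simp only [mul_comm (v _)] at h2
    have h3 : (μ - μ₁) * ∫ x in Ω, φ₁ x * v x = 0 := by linarith
    exact (mul_eq_zero.1 h3).resolve_left (sub_ne_zero.2 hne)
  have hP := hv.mem.polarization hs hΩs
  have hPsq : ∫ x in Ω, polarization v x * polarization v x = ∫ x in Ω, v x * v x :=
    setIntegral_eq_of_add_refl_eq hΩs (hP.1.integrable_mul hP.1)
      (hv.mem.1.integrable_mul hv.mem.1) (Filter.Eventually.of_forall fun x => by
        simpa only [sq] using polarization_sq_add_polarization_refl_sq v x)
  have hPorth : ∫ x in Ω, φ₁ x * polarization v x = 0 := by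
    rw [← hvorth]
    refine setIntegral_eq_of_add_refl_eq hΩs (hφ₁.mem.1.integrable_mul hP.1)
      (hφ₁.mem.1.integrable_mul hv.mem.1) ?_
    filter_upwards [hφ₁sym] with x hx
    rw [hx, ← mul_add, ← mul_add, polarization_add_polarization_refl]
  have hPpot : ∫ x in Ω, p * |u x| ^ (p - 1) * polarization v x * polarization v x =
      ∫ x in Ω, p * |u x| ^ (p - 1) * v x * v x := by
    refine setIntegral_eq_of_add_refl_eq hΩs (hu.integrable_potential hE hP.1 hP.1)
      (hu.integrable_potential hE hv.mem.1 hv.mem.1) ?_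
    filter_upwards [hsym] with x hx
    rw [hx]
    linear_combination (p * |u x| ^ (p - 1)) * polarization_sq_add_polarization_refl_sq v x
  have hPle : linForm Ω s lam p u (polarization v) (polarization v) ≤
      linForm Ω s lam p u v v := by
    unfold linForm
    rw [hPsq, hPpot]
    linarith [energy_polarization_le hs hE.s_lt_one hv.mem.1]
  have hP0 : ¬ polarization v =ᵐ[volume] 0 := fun h0 => by
    have h1 := hv.mem.setIntegral_mul_self_pos hΩ hv.ne_zero
    rw [← hPsq, (linForm_of_ae_zero (Ω := Ω) (lam := lam) (p := p) (u := u) hs h0).2] at h1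
    exact lt_irrefl _ h1
  have hmin : ∀ φ, MemHs0 Ω s φ ∧ ∫ x in Ω, φ₁ x * φ x = 0 →
      μ * ∫ x in Ω, φ x * φ x ≤ linForm Ω s lam p u φ φ := fun φ hφ =>
    mul_le_linForm_of_lowerBound (X := fun φ => ∫ x in Ω, φ₁ x * φ x = 0) hs hΩ
      (fun φ h1 h2 h3 => hlow ⟨φ, h1, h2, h3, rfl⟩) hφ.1 hφ.2
  have hadd : ∀ φ ψ : Space N → ℝ, MemHs0 Ω s φ → MemHs0 Ω s ψ → ∀ c : ℝ,
      ∫ x in Ω, φ₁ x * (φ x + c * ψ x) =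
        (∫ x in Ω, φ₁ x * φ x) + c * ∫ x in Ω, φ₁ x * ψ x := fun φ ψ hφ hψ c => by
    simp only [mul_add, mul_left_comm _ c]
    rw [integral_add (hφ₁.mem.1.integrable_mul hφ.1).integrableOn
      ((hφ₁.mem.1.integrable_mul hψ.1).const_mul c).integrableOn, integral_const_mul]
  refine ⟨hP, hP0, fun ψ hψ => ?_⟩
  -- Split `ψ` into a multiple of `φ₁` and a function orthogonal to `φ₁`.
  set c : ℝ := (∫ x in Ω, φ₁ x * ψ x) / ∫ x in Ω, φ₁ x * φ₁ x with hc
  have hφ₁pos := hφ₁.mem.setIntegral_mul_self_pos hΩ hφ₁.ne_zero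
  have hψ' : MemHs0 Ω s (fun x => ψ x + -c * φ₁ x) := hψ.add (hφ₁.mem.const_mul _)
  have hψorth : ∫ x in Ω, φ₁ x * (ψ x + -c * φ₁ x) = 0 := by
    rw [hadd _ _ hψ hφ₁.mem, hc, neg_mul, div_mul_cancel₀ _ hφ₁pos.ne', add_neg_cancel]
  have h1 := weak_eq_of_minimizer hE hu
    (X := fun φ => MemHs0 Ω s φ ∧ ∫ x in Ω, φ₁ x * φ x = 0) (fun _ h => h.1.1)
    (fun φ ψ c h h' => ⟨h.1.add (h'.1.const_mul c), by
      rw [hadd _ _ h.1 h'.1, h.2, h'.2, mul_zero, add_zero]⟩) hmin ⟨hP, hPorth⟩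
    (le_antisymm (by rw [hPsq, ← hv.weak_eq _ hv.mem]; exact hPle) (hmin _ ⟨hP, hPorth⟩))
    ⟨hψ', hψorth⟩
  have h2 : linForm Ω s lam p u (polarization v) φ₁ = 0 := by
    rw [linForm_comm, hφ₁.weak_eq _ hP, hPorth, mul_zero]
  rw [linForm_comm, linForm_add_left hE hu hψ.1 (hφ₁.mem.1.const_mul _) hP.1,
    linForm_mul_left hs, linForm_comm φ₁, h2, mul_zero, add_zero, linForm_comm] at h1
  rw [h1]
  congr 1
  have h3 : ∀ x, polarization v x * (ψ x + -c * φ₁ x) =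
      polarization v x * ψ x + -c * (φ₁ x * polarization v x) := fun x => by ring
  simp only [h3]
  rw [integral_add (hP.1.integrable_mul hψ.1).integrableOn
    ((hφ₁.mem.1.integrable_mul hP.1).const_mul (-c)).integrableOn, integral_const_mul, hPorth,
    mul_zero, add_zero]

end

section

variable {N : ℕ} {s : ℝ}

/-! ### Lipschitz cut-off functions -/

/-- A Lipschitz cut-off function, positive exactly in the open set `D`: the distance to the
complement, truncated at `1`. -/
def cutoff (D : Set (Space N)) (x : Space N) : ℝ := min 1 (Metric.infDist x Dᶜ)

lemma cutoff_nonneg (D : Set (Space N)) (x : Space N) : 0 ≤ cutoff D x :=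
  le_min zero_le_one Metric.infDist_nonneg

lemma cutoff_le_one (D : Set (Space N)) (x : Space N) : cutoff D x ≤ 1 := min_le_left _ _

lemma cutoff_of_notMem {D : Set (Space N)} {x : Space N} (hx : x ∉ D) : cutoff D x = 0 := by
  rw [cutoff, Metric.infDist_zero_of_mem (show x ∈ Dᶜ from hx)]
  simp

lemma cutoff_pos [NeZero N] {D : Set (Space N)} (hD : IsOpen D) (hb : Bornology.IsBounded D)
    {x : Space N} (hx : x ∈ D) : 0 < cutoff D x := by
  have : Nontrivial (Space N) := by
    have : Nonempty (Fin N) := ⟨0⟩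
    infer_instance
  have hne : Dᶜ.Nonempty := by
    rw [Set.nonempty_compl]
    rintro rfl
    exact NormedSpace.unbounded_univ ℝ (Space N) hb
  exact lt_min one_pos
    ((hD.isClosed_compl.notMem_iff_infDist_pos hne).1 (Set.notMem_compl_iff.2 hx))

lemma continuous_cutoff (D : Set (Space N)) : Continuous (cutoff D) :=
  continuous_const.min (Metric.continuous_infDist_pt _)

lemma abs_cutoff_sub_le (D : Set (Space N)) (x y : Space N) :
    |cutoff D x - cutoff D y| ≤ min 1 ‖x - y‖ := by
  refine le_min ?_ ?_
  · rw [abs_sub_le_iff]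
    constructor <;> linarith [cutoff_nonneg D x, cutoff_nonneg D y, cutoff_le_one D x,
      cutoff_le_one D y]
  · refine (abs_min_sub_min_le_max _ _ _ _).trans ?_
    rw [sub_self, abs_zero, max_eq_right (abs_nonneg _), ← Real.dist_eq, ← dist_eq_norm]
    simpa using (Metric.lipschitz_infDist_pt Dᶜ).dist_le_mul x y

lemma integrable_min_sq_mul_kernel [NeZero N] (hs : 0 < s) (hs1 : s < 1) :
    Integrable fun x : Space N => min 1 ‖x‖ ^ 2 * (‖x‖ ^ ((N : ℝ) + 2 * s))⁻¹ := by
  have : Nontrivial (Space N) := by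
    have : Nonempty (Fin N) := ⟨0⟩
    infer_instance
  have hN : 1 ≤ N := Nat.pos_of_ne_zero (NeZero.ne N)
  refine (integrable_fun_norm_addHaar volume
    (f := fun r : ℝ => min 1 r ^ 2 * (r ^ ((N : ℝ) + 2 * s))⁻¹)).2 ?_
  rw [finrank_euclideanSpace, Fintype.card_fin]
  have hm : Measurable fun r : ℝ => r ^ (N - 1) • (min 1 r ^ 2 * (r ^ ((N : ℝ) + 2 * s))⁻¹) := by
    fun_prop
  have hrw : ∀ r : ℝ, 0 < r → r ^ (N - 1) • (min 1 r ^ 2 * (r ^ ((N : ℝ) + 2 * s))⁻¹) =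
      min 1 r ^ 2 * r ^ (-1 - 2 * s) := fun r hr => by
    have h1 : r ^ (N - 1) = r ^ ((N : ℝ) - 1) := by
      rw [← Real.rpow_natCast]
      congr 1
      push_cast [hN]
      ring
    rw [smul_eq_mul, h1, ← Real.rpow_neg hr.le, mul_left_comm, ← Real.rpow_add hr]
    congr 2
    ring
  rw [← Set.Ioc_union_Ioi_eq_Ioi (zero_le_one (α := ℝ)), integrableOn_union]
  constructor
  · have h1 : IntegrableOn (fun r : ℝ => r ^ (1 - 2 * s)) (Set.Ioc 0 1) :=
      (intervalIntegrable_iff_integrableOn_Ioc_of_le zero_le_one).1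
        (intervalIntegral.intervalIntegrable_rpow' (by linarith))
    refine h1.mono' hm.aestronglyMeasurable ((ae_restrict_iff' measurableSet_Ioc).2
      (Filter.Eventually.of_forall fun r hr => ?_))
    rw [hrw r hr.1, Real.norm_of_nonneg (mul_nonneg (sq_nonneg _) (Real.rpow_nonneg hr.1.le _)),
      min_eq_right hr.2, ← Real.rpow_natCast, ← Real.rpow_add hr.1]
    refine le_of_eq ?_
    congr 1
    push_cast
    ring
  · have h1 : IntegrableOn (fun r : ℝ => r ^ (-1 - 2 * s)) (Set.Ioi 1) :=
      integrableOn_Ioi_rpow_of_lt (by linarith) one_pos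
    refine h1.mono' hm.aestronglyMeasurable ((ae_restrict_iff' measurableSet_Ioi).2
      (Filter.Eventually.of_forall fun r hr => ?_))
    have hr' : (1 : ℝ) < r := hr
    have hr0 : 0 < r := by linarith
    rw [hrw r hr0, Real.norm_of_nonneg (mul_nonneg (sq_nonneg _) (Real.rpow_nonneg hr0.le _)),
      min_eq_left hr'.le]
    simp

lemma memHs_cutoff [NeZero N] (hs : 0 < s) (hs1 : s < 1) {D : Set (Space N)} (hD : IsOpen D)
    (hb : Bornology.IsBounded D) : MemHs s (cutoff D) := by
  have hcm := (continuous_cutoff D).aestronglyMeasurable (μ := volume)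
  have hDi : Integrable (D.indicator fun _ => (1 : ℝ)) :=
    (integrable_indicator_iff hD.measurableSet).2
      (integrableOn_const (hb.measure_lt_top).ne)
  have hL2 : MemLp (cutoff D) 2 := by
    rw [memLp_two_iff_integrable_sq hcm]
    refine hDi.mono' (hcm.pow 2) (Filter.Eventually.of_forall fun x => ?_)
    rw [Real.norm_of_nonneg (sq_nonneg _)]
    by_cases hx : x ∈ D
    · rw [Set.indicator_of_mem hx]
      nlinarith [cutoff_nonneg D x, cutoff_le_one D x]
    · simp [cutoff_of_notMem hx, hx]
  refine memHs_iff.2 ⟨hL2, ?_⟩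
  have hdm := aestronglyMeasurable_diffQuot (s := s) hcm
  rw [memLp_two_iff_integrable_sq hdm]
  have hg := integrable_min_sq_mul_kernel (N := N) hs hs1
  have h1 := hDi.convolution_integrand (ContinuousLinearMap.mul ℝ ℝ) hg
  have h2 : Integrable fun z : Space N × Space N => D.indicator (fun _ => (1 : ℝ)) z.1 *
      (min 1 ‖z.2 - z.1‖ ^ 2 * (‖z.2 - z.1‖ ^ ((N : ℝ) + 2 * s))⁻¹) := h1.swap
  refine (h1.add h2).mono' (hdm.pow 2) (Filter.Eventually.of_forall fun z => ?_)
  simp only [Pi.add_apply, ContinuousLinearMap.mul_apply', norm_sub_rev z.2]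
  rw [Real.norm_of_nonneg (sq_nonneg _), sq, diffQuot_mul hs, div_eq_mul_inv, ← add_mul,
    ← mul_assoc]
  refine mul_le_mul_of_nonneg_right ?_ (by positivity)
  have h3 : (cutoff D z.1 - cutoff D z.2) * (cutoff D z.1 - cutoff D z.2) ≤
      min 1 ‖z.1 - z.2‖ ^ 2 := by
    rw [← abs_mul_abs_self, ← sq]
    exact pow_le_pow_left₀ (abs_nonneg _) (abs_cutoff_sub_le D _ _) 2
  have h4 : 0 ≤ min 1 ‖z.1 - z.2‖ ^ 2 := sq_nonneg _
  by_cases hz1 : z.1 ∈ D <;> by_cases hz2 : z.2 ∈ D <;>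
    simp only [Set.indicator_of_mem, Set.indicator_of_notMem, hz1, hz2, cutoff_of_notMem,
      not_false_eq_true, sub_self, mul_zero, zero_add, add_zero, one_mul, zero_mul, le_refl]
      at h3 ⊢ <;> nlinarith

lemma memHs0_cutoff [NeZero N] (hs : 0 < s) (hs1 : s < 1) {D : Set (Space N)} (hD : IsOpen D)
    (hb : Bornology.IsBounded D) : MemHs0 D s (cutoff D) :=
  ⟨memHs_cutoff hs hs1 hD hb, Filter.Eventually.of_forall fun _ => cutoff_of_notMem⟩

/-! ### Maximum principles for antisymmetric functions -/

variable [NeZero N] {t : ℝ}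

/-- Testing with the positive part on a half-space of an odd function controls the energy of that
positive part. -/
lemma energy_oddPosPart_le (hs : 0 < s) (hs1 : s < 1) {w : Space N → ℝ} (hw : MemHs s w)
    (hodd : ∀ x, w (refl t x) = -w x) :
    energy s (fun x => if t < x 0 then max (w x) 0 else 0)
      (fun x => if t < x 0 then max (w x) 0 else 0) ≤
    energy s w (fun x => if t < x 0 then max (w x) 0 else 0) := by
  have hg := hw.oddPosPart hs hodd
  have hc := normConst_pos (N := N) hs hs1
  rw [energy_eq hs, energy_eq hs]
  refine mul_le_mul_of_nonneg_left (integral_le_of_fold_le (t := t)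
    (hg.integrable_diffQuot_mul hg) (hw.integrable_diffQuot_mul hg)
    (Filter.Eventually.of_forall fun z h1 h2 h3 => ?_)) (by positivity)
  have h1' : ¬ t < 2 * t - z.1 0 := by linarith
  have h2' : ¬ t < 2 * t - z.2 0 := by linarith
  have hj := kernel_nonneg (s := s) z.1 (refl t z.2)
  have hkj := sub_nonneg.2 (kernel_refl_lt hs h1 h2 h3).le
  simp only [fold_diffQuot_mul hs, refl_zero, h1, h2, h1', h2', hodd, if_true, if_false]
  generalize w z.1 = a, w z.2 = b, kernel s z.1 z.2 = k, kernel s z.1 (refl t z.2) = j at *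
  rcases le_total 0 a with ha | ha <;> rcases le_total 0 b with hb | hb <;>
    simp only [max_eq_left, max_eq_right, ha, hb]
  · nlinarith [mul_nonneg hj (mul_nonneg ha hb)]
  · nlinarith [mul_nonneg hkj (mul_nonneg ha (neg_nonneg.2 hb))]
  · nlinarith [mul_nonneg hkj (mul_nonneg hb (neg_nonneg.2 ha))]
  · nlinarith

/-- Cut-off functions of a real variable that decrease to the indicator of `{0}`. -/
def zeroBump (n : ℕ) (a : ℝ) : ℝ := max 0 (1 - (n + 1) * |a|)

lemma zeroBump_nonneg (n : ℕ) (a : ℝ) : 0 ≤ zeroBump n a := le_max_left _ _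

lemma zeroBump_le_one (n : ℕ) (a : ℝ) : zeroBump n a ≤ 1 :=
  max_le zero_le_one (by have : 0 ≤ ((n : ℝ) + 1) * |a| := by positivity
                         linarith)

lemma zeroBump_zero (n : ℕ) : zeroBump n 0 = 1 := by simp [zeroBump]

lemma abs_zeroBump_sub_le (n : ℕ) (a b : ℝ) :
    |zeroBump n a - zeroBump n b| ≤ |(n + 1) * a - (n + 1) * b| := by
  refine (abs_max_sub_max_le_max _ _ _ _).trans ?_
  rw [sub_self, abs_zero, max_eq_right (abs_nonneg _),
    show 1 - ((n : ℝ) + 1) * |a| - (1 - (n + 1) * |b|) = (n + 1) * (|b| - |a|) by ring,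
    ← mul_sub, abs_mul, abs_mul, abs_sub_comm a]
  exact mul_le_mul_of_nonneg_left (abs_abs_sub_abs_le_abs_sub b a) (abs_nonneg _)

lemma zeroBump_anti (n : ℕ) {a b : ℝ} (ha : 0 ≤ a) (hab : a ≤ b) : zeroBump n b ≤ zeroBump n a := by
  unfold zeroBump
  rw [abs_of_nonneg ha, abs_of_nonneg (ha.trans hab)]
  gcongr

lemma measurable_zeroBump (n : ℕ) : Measurable (zeroBump n) := by
  unfold zeroBump; fun_prop

lemma tendsto_zeroBump (a : ℝ) :
    Filter.Tendsto (fun n => zeroBump n a) Filter.atTop (nhds (if a = 0 then 1 else 0)) := by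
  split_ifs with ha
  · simp [ha, zeroBump_zero]
  · refine tendsto_const_nhds.congr' ?_
    filter_upwards [Filter.eventually_ge_atTop ⌈1 / |a|⌉₊] with n hn
    have ha' : 0 < |a| := abs_pos.2 ha
    have h1 : 1 / |a| ≤ n := (Nat.le_ceil _).trans (by exact_mod_cast hn)
    rw [div_le_iff₀ ha'] at h1
    rw [zeroBump, max_eq_left (by linarith)]

/-- **Strong maximum principle** for antisymmetric functions. If `w` is odd with respect to
`{x₁ = t}`, non-negative on `{x₁ > t}` and a weak solution of `(-Δ)^s w = F` in `D` with `F`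
vanishing wherever `w` does, then `w` either is non-zero almost everywhere in `D`, or vanishes in
the whole half-space. The equation is tested with functions that approximate the indicator of
`{w = 0}`; after folding, the energy converges (Fatou) to the negative interaction of `{w = 0}`
with `{w > 0}`, while the right hand side converges to zero. -/
theorem strong_maximum_principle (hs : 0 < s) (hs1 : s < 1) {D : Set (Space N)} (hD : IsOpen D)
    (hb : Bornology.IsBounded D) (hDt : ∀ x ∈ D, t < x 0) {w F : Space N → ℝ}
    (hwm : Measurable w) (hw : MemHs s w) (hodd : ∀ x, w (refl t x) = -w x)
    (hw0 : ∀ᵐ x : Space N, t < x 0 → 0 ≤ w x)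
    (hFi : ∀ φ, MemHs0 D s φ → Integrable fun x => F x * φ x)
    (hF : ∀ φ, MemHs0 D s φ → energy s w φ = ∫ x, F x * φ x)
    (hF0 : ∀ x, w x = 0 → F x = 0) :
    (∀ᵐ x, x ∈ D → w x ≠ 0) ∨ ∀ᵐ x : Space N, t < x 0 → w x = 0 := by
  have hc := normConst_pos (N := N) hs hs1
  set χ := cutoff D with hχ
  have hχ0 : ∀ x, 0 ≤ χ x := cutoff_nonneg D
  have hχ1 : ∀ x, χ x ≤ 1 := cutoff_le_one D
  have hχm : Measurable χ := (continuous_cutoff D).measurable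
  have hχs : MemHs s χ := memHs_cutoff hs hs1 hD hb
  have hχr : ∀ x : Space N, t < x 0 → χ (refl t x) = 0 := fun x hx =>
    cutoff_of_notMem fun h => by
      have := hDt _ h
      rw [refl_zero] at this
      linarith
  set φ : ℕ → Space N → ℝ := fun n x => zeroBump n (w x) * χ x with hφ
  set ψ : Space N → ℝ := fun x => (if w x = 0 then 1 else 0) * χ x with hψ
  have hφm : ∀ n, Measurable (φ n) := fun n => ((measurable_zeroBump n).comp hwm).mul hχm
  have hψm : Measurable ψ :=
    (Measurable.ite (hwm (measurableSet_singleton 0)) measurable_const measurable_const).mul hχm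
  have hφ0 : ∀ n x, 0 ≤ φ n x := fun n x => mul_nonneg (zeroBump_nonneg _ _) (hχ0 x)
  have hφχ : ∀ n x, φ n x ≤ χ x := fun n x =>
    mul_le_of_le_one_left (hχ0 x) (zeroBump_le_one _ _)
  have hφD : ∀ n, MemHs0 D s (φ n) := fun n => by
    refine ⟨(hw.const_mul ((n : ℝ) + 1)).of_dominated hχs (hφm n).aestronglyMeasurable
      (fun x => ?_) (fun x y => ?_), Filter.Eventually.of_forall fun x hx => ?_⟩
    · rw [abs_of_nonneg (hφ0 n x), abs_of_nonneg (hχ0 x)]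
      linarith [hφχ n x, abs_nonneg (((n : ℝ) + 1) * w x)]
    · have h1 : φ n x - φ n y = (zeroBump n (w x) - zeroBump n (w y)) * χ x +
          zeroBump n (w y) * (χ x - χ y) := by simp only [hφ]; ring
      rw [h1]
      refine (abs_add_le _ _).trans (add_le_add ?_ ?_)
      · rw [abs_mul, abs_of_nonneg (hχ0 x)]
        exact (mul_le_of_le_one_right (abs_nonneg _) (hχ1 x)).trans (abs_zeroBump_sub_le _ _ _)
      · rw [abs_mul, abs_of_nonneg (zeroBump_nonneg _ _)]
        exact mul_le_of_le_one_left (abs_nonneg _) (zeroBump_le_one _ _)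
    · simp only [hφ, hχ, cutoff_of_notMem hx, mul_zero]
  have hφψ : ∀ x, Filter.Tendsto (fun n => φ n x) Filter.atTop (nhds (ψ x)) := fun x =>
    (tendsto_zeroBump (w x)).mul_const _
  -- The right hand sides tend to zero by dominated convergence.
  have hrhs : Filter.Tendsto (fun n => ∫ x, F x * φ n x) Filter.atTop (nhds 0) := by
    have h1 := tendsto_integral_of_dominated_convergence (μ := volume)
      (F := fun n x => F x * φ n x) (f := fun x => F x * ψ x) (fun x => |F x * χ x|)
      (fun n => (hFi _ (hφD n)).1) (hFi _ (memHs0_cutoff hs hs1 hD hb)).abs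
      (fun n => Filter.Eventually.of_forall fun x => by
        rw [Real.norm_eq_abs, abs_mul (F x), abs_mul (F x), abs_of_nonneg (hφ0 n x),
          abs_of_nonneg (hχ0 x)]
        exact mul_le_mul_of_nonneg_left (hφχ n x) (abs_nonneg _))
      (Filter.Eventually.of_forall fun x => (hφψ x).const_mul _)
    have h2 : ∀ x, F x * ψ x = 0 := fun x => by
      by_cases hx : w x = 0
      · rw [hF0 x hx, zero_mul]
      · simp [hψ, hx]
    simpa only [h2, integral_zero] using h1
  set Φ : ℕ → Space N × Space N → ℝ := fun n z => diffQuot s w z * diffQuot s (φ n) z with hΦ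
  set Ψ : Space N × Space N → ℝ := fun z => diffQuot s w z * diffQuot s ψ z with hΨ
  set χ' : Space N → ℝ := fun x => χ x - χ (refl t x) with hχ'
  have hχ's : MemHs s χ' := hχs.sub (hχs.comp_refl t)
  set G : Space N × Space N → ℝ := fun z => |diffQuot s w z * diffQuot s χ' z| with hG
  have hΦi : ∀ n, Integrable (Φ n) := fun n => hw.integrable_diffQuot_mul (hφD n).1
  have hGi : Integrable G := (hw.integrable_diffQuot_mul hχ's).abs
  have hΦlim : Filter.Tendsto (fun n => ∫ z, fold t (Φ n) z) Filter.atTop (nhds 0) := by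
    have h1 : ∀ n, ∫ z, fold t (Φ n) z = 8 / normConst N s * ∫ x, F x * φ n x := fun n => by
      rw [integral_fold (hΦi n), ← hF _ (hφD n), energy_eq hs]
      field_simp
      ring
    simp only [h1]
    simpa using hrhs.const_mul (8 / normConst N s)
  have hw2 : ∀ᵐ z : Space N × Space N, (t < z.1 0 → 0 ≤ w z.1) ∧ (t < z.2 0 → 0 ≤ w z.2) :=
    (ae_fst hw0).and (ae_snd hw0)
  have hΦG : ∀ n, ∀ᵐ z, fold t (Φ n) z ≤ fold t G z := fun n => by
    refine fold_le_ae ?_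
    filter_upwards [hw2] with z hz h1 h2 h3
    have ha := hz.1 h1
    have hb := hz.2 h2
    have hr : ∀ x : Space N, t < x 0 → φ n (refl t x) = 0 := fun x hx => by
      simp only [hφ, hχr x hx, mul_zero]
    simp only [fold, hΦ, hG, diffQuot_mul_eq_kernel hs, abs_mul, abs_of_nonneg (kernel_nonneg _ _),
      hχ', refl_refl, hχr _ h1, hχr _ h2, hr _ h1, hr _ h2, hodd]
    have hφx := hφχ n z.1
    have hφy := hφχ n z.2
    have hφx0 := hφ0 n z.1
    have hφy0 := hφ0 n z.2
    refine add_le_add (add_le_add (add_le_add ?_ ?_) ?_) ?_ <;>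
      refine mul_le_mul_of_nonneg_left ?_ (kernel_nonneg _ _)
    · -- Monotonicity of the bump makes the product no larger than for the bare cut-off.
      rw [sub_zero, sub_zero]
      rcases le_total (w z.1) (w z.2) with h | h
      · have h4 : φ n z.2 - φ n z.1 ≤ |χ z.1 - χ z.2| := by
          have h5 := mul_le_mul_of_nonneg_right (zeroBump_anti n ha h) (hχ0 z.2)
          have h6 : φ n z.2 - φ n z.1 ≤ zeroBump n (w z.1) * (χ z.2 - χ z.1) := by
            simp only [hφ]; linarith
          refine h6.trans ?_
          rw [abs_sub_comm]
          exact (mul_le_mul_of_nonneg_left (le_abs_self _) (zeroBump_nonneg _ _)).trans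
            (mul_le_of_le_one_left (abs_nonneg _) (zeroBump_le_one _ _))
        rw [abs_of_nonpos (sub_nonpos.2 h)]
        nlinarith [sub_nonneg.2 h]
      · have h4 : φ n z.1 - φ n z.2 ≤ |χ z.1 - χ z.2| := by
          have h5 := mul_le_mul_of_nonneg_right (zeroBump_anti n hb h) (hχ0 z.1)
          have h6 : φ n z.1 - φ n z.2 ≤ zeroBump n (w z.2) * (χ z.1 - χ z.2) := by
            simp only [hφ]; linarith
          refine h6.trans ?_
          exact (mul_le_mul_of_nonneg_left (le_abs_self _) (zeroBump_nonneg _ _)).trans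
            (mul_le_of_le_one_left (abs_nonneg _) (zeroBump_le_one _ _))
        rw [abs_of_nonneg (sub_nonneg.2 h)]
        nlinarith [sub_nonneg.2 h]
    · rw [sub_self, mul_zero]
      positivity
    · rw [abs_of_nonneg (by linarith), abs_of_nonneg (by linarith [hχ0 z.1, hχ0 z.2])]
      nlinarith [hχ0 z.2]
    · rw [abs_of_nonpos (by linarith), abs_of_nonpos (by linarith [hχ0 z.1, hχ0 z.2])]
      nlinarith [hχ0 z.1]
  have hψr : ∀ x : Space N, t < x 0 → ψ (refl t x) = 0 := fun x hx => by
    simp only [hψ, hχr x hx, mul_zero]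
  have hψ0 : ∀ x, 0 ≤ ψ x := fun x => mul_nonneg (by split_ifs <;> simp) (hχ0 x)
  have hwψ : ∀ x, w x * ψ x = 0 := fun x => by
    by_cases hx : w x = 0 <;> simp [hψ, hx]
  have hΨeq : ∀ z : Space N × Space N, t < z.1 0 → t < z.2 0 → fold t Ψ z =
      -((kernel s z.1 z.2 - kernel s z.1 (refl t z.2)) * (w z.1 * ψ z.2 + w z.2 * ψ z.1)) :=
    fun z h1 h2 => by
      simp only [hΨ]
      rw [fold_diffQuot_mul hs, hψr _ h1, hψr _ h2, hodd, hodd]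
      linear_combination (kernel s z.1 z.2 + kernel s z.1 (refl t z.2)) *
        (hwψ z.1 + hwψ z.2)
  have hΨ0 : ∀ᵐ z, fold t Ψ z ≤ 0 := by
    refine ae_of_ae_halfSpace (t := t) (P := fun z => fold t Ψ z ≤ 0)
      (fun z hz => by simpa only [fold_left] using hz)
      (fun z hz => by simpa only [fold_right] using hz) ?_
    filter_upwards [hw2] with z hz h1 h2 h3
    rw [hΨeq z h1 h2, neg_nonpos]
    exact mul_nonneg (sub_nonneg.2 (kernel_refl_lt hs h1 h2 h3).le)
      (add_nonneg (mul_nonneg (hz.1 h1) (hψ0 _)) (mul_nonneg (hz.2 h2) (hψ0 _)))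
  have hΨm : Measurable (fold t Ψ) := by
    have h1 : Measurable Ψ := by
      simp only [hΨ, diffQuot_mul hs]
      exact (((hwm.comp measurable_fst).sub (hwm.comp measurable_snd)).mul
        ((hψm.comp measurable_fst).sub (hψm.comp measurable_snd))).div (measurable_norm_rpow _)
    exact ((h1.add (h1.comp measurePreserving_both.measurable)).add
      (h1.comp measurePreserving_right.measurable)).add
      (h1.comp measurePreserving_left.measurable)
  have hΦΨ : ∀ z, Filter.Tendsto (fun n => fold t (Φ n) z) Filter.atTop (nhds (fold t Ψ z)) := by
    have h1 : ∀ z, Filter.Tendsto (fun n => Φ n z) Filter.atTop (nhds (Ψ z)) := fun z =>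
      (((hφψ z.1).sub (hφψ z.2)).div_const _).const_mul _
    exact fun z => (((h1 _).add (h1 _)).add (h1 _)).add (h1 _)
  have hGf := integrable_fold (t := t) hGi
  -- Fatou's lemma for `fold t G - fold t (Φ n) ≥ 0`.
  have hfatou : ∫⁻ z, ENNReal.ofReal (fold t G z - fold t Ψ z) ≤
      ENNReal.ofReal (∫ z, fold t G z) := by
    calc ∫⁻ z, ENNReal.ofReal (fold t G z - fold t Ψ z)
        = ∫⁻ z, Filter.liminf (fun n => ENNReal.ofReal (fold t G z - fold t (Φ n) z))
            Filter.atTop := by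
          refine lintegral_congr fun z => (Filter.Tendsto.liminf_eq ?_).symm
          exact ENNReal.tendsto_ofReal ((hΦΨ z).const_sub _)
      _ ≤ Filter.liminf (fun n => ∫⁻ z, ENNReal.ofReal (fold t G z - fold t (Φ n) z))
            Filter.atTop := lintegral_liminf_le' fun n =>
          (hGf.sub (integrable_fold (hΦi n))).1.aemeasurable.ennreal_ofReal
      _ = ENNReal.ofReal (∫ z, fold t G z) := by
          refine Filter.Tendsto.liminf_eq ?_
          have h1 : ∀ n, ∫⁻ z, ENNReal.ofReal (fold t G z - fold t (Φ n) z) =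
              ENNReal.ofReal ((∫ z, fold t G z) - ∫ z, fold t (Φ n) z) := fun n => by
            rw [← integral_sub hGf (integrable_fold (hΦi n))]
            refine (ofReal_integral_eq_lintegral_ofReal (hGf.sub (integrable_fold (hΦi n)))
              ?_).symm
            filter_upwards [hΦG n] with z hz
            exact sub_nonneg.2 hz
          simp only [h1]
          have h2 := ENNReal.tendsto_ofReal (hΦlim.const_sub (∫ z, fold t G z))
          rwa [sub_zero] at h2
  have hG0 : ∀ z, 0 ≤ fold t G z := fun z => by
    simp only [fold, hG]
    positivity
  have hsub0 : 0 ≤ᵐ[volume] fun z => fold t G z - fold t Ψ z := by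
    filter_upwards [hΨ0] with z hz
    simp only [Pi.zero_apply]
    linarith [hG0 z]
  have hsubm : AEStronglyMeasurable (fun z => fold t G z - fold t Ψ z) volume :=
    hGf.1.sub hΨm.aestronglyMeasurable
  have hsubi : Integrable fun z => fold t G z - fold t Ψ z := by
    refine ⟨hsubm, ?_⟩
    rw [hasFiniteIntegral_iff_ofReal hsub0]
    exact hfatou.trans_lt ENNReal.ofReal_lt_top
  have hΨi : Integrable (fold t Ψ) := by
    refine (hGf.sub hsubi).congr (Filter.Eventually.of_forall fun z => ?_)
    simp
  have hΨint : ∫ z, -fold t Ψ z ≤ 0 := by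
    rw [← ofReal_integral_eq_lintegral_ofReal hsubi hsub0, ENNReal.ofReal_le_ofReal_iff
      (integral_nonneg hG0), integral_sub hGf hΨi] at hfatou
    rw [integral_neg]
    linarith
  have hneg0 : 0 ≤ᵐ[volume] fun z => -fold t Ψ z := by
    filter_upwards [hΨ0] with z hz
    simpa using hz
  have hzero := (integral_eq_zero_iff_of_nonneg_ae hneg0 hΨi.neg).1
    (le_antisymm hΨint (integral_nonneg_of_ae hneg0))
  have hfin : ∀ᵐ z : Space N × Space N,
      ¬ ((z.1 ∈ D ∧ w z.1 = 0) ∧ (t < z.2 0 ∧ w z.2 ≠ 0)) := by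
    filter_upwards [hzero, hw2, ae_fst_ne_snd] with z hz hz2 hne
    rintro ⟨⟨h1, h2⟩, h3, h4⟩
    have h5 := hDt _ h1
    have h6 : 0 < w z.2 := lt_of_le_of_ne (hz2.2 h3) (Ne.symm h4)
    have h7 : 0 < ψ z.1 := by
      simp only [hψ, h2, if_true, one_mul]
      exact cutoff_pos hD hb h1
    have h8 := sub_pos.2 (kernel_refl_lt hs h5 h3 hne)
    rw [hΨeq z h5 h3, neg_neg, h2, zero_mul, zero_add, Pi.zero_apply] at hz
    exact (mul_pos h8 (mul_pos h6 h7)).ne' hz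
  rcases ae_or_ae_of_prod (P := fun x => x ∈ D ∧ w x = 0) (Q := fun x => t < x 0 ∧ w x ≠ 0) hfin
    with h | h
  · left
    filter_upwards [h] with x hx h1 h2
    exact hx ⟨h1, h2⟩
  · right
    filter_upwards [h] with x hx h1
    by_contra h2
    exact hx ⟨h1, h2⟩

end

section

variable {N : ℕ} [NeZero N] {s p lam t : ℝ} {Ω : Set (Space N)} {u : Space N → ℝ}

/-! ### Non-negative solutions and their reflections -/

/-- A non-negative solution represented by a measurable function that is non-negative and vanishes
outside `Ω` everywhere, not only almost everywhere. -/
structure IsPreciseSolution (Ω : Set (Space N)) (s lam p : ℝ) (u : Space N → ℝ) : Prop where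
  measurable : Measurable u
  nonneg : ∀ x, 0 ≤ u x
  eq_zero : ∀ x, x ∉ Ω → u x = 0
  memHs : MemHs s u
  weak_eq : ∀ φ : Space N → ℝ, MemHs0 Ω s φ →
    energy s u φ + lam * ∫ x in Ω, u x * φ x = ∫ x in Ω, u x ^ p * φ x

omit [NeZero N] in
lemma IsNonnegSolution.exists_precise (hs : 0 < s) (hΩ : MeasurableSet Ω)
    (hu : IsNonnegSolution Ω s lam p u) :
    ∃ u', u =ᵐ[volume] u' ∧ IsPreciseSolution Ω s lam p u' := by
  have hm := hu.mem.1.1.1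
  set u' : Space N → ℝ := Ω.indicator fun x => |hm.mk u x| with hu'
  have hae : u =ᵐ[volume] u' := by
    filter_upwards [hm.ae_eq_mk, hu.nonneg, hu.mem.2] with x h1 h2 h3
    by_cases hx : x ∈ Ω
    · rw [hu', Set.indicator_of_mem hx, ← h1, abs_of_nonneg h2]
    · rw [hu', Set.indicator_of_notMem hx, h3 hx]
  refine ⟨u', hae, ?_, fun x => Set.indicator_nonneg (fun _ _ => abs_nonneg _) x,
    fun x hx => Set.indicator_of_notMem hx _, hu.mem.1.congr hae, fun φ hφ => ?_⟩
  · exact (continuous_abs.measurable.comp hm.stronglyMeasurable_mk.measurable).indicator hΩ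
  · rw [← energy_congr hs hae (Filter.EventuallyEq.refl _ φ)]
    have h1 : ∫ x in Ω, u' x * φ x = ∫ x in Ω, u x * φ x := integral_congr_ae (by
      filter_upwards [ae_restrict_of_ae hae] with x hx
      rw [hx])
    have h2 : ∫ x in Ω, u' x ^ p * φ x = ∫ x in Ω, u x ^ p * φ x := integral_congr_ae (by
      filter_upwards [ae_restrict_of_ae hae] with x hx
      rw [hx])
    rw [h1, h2]
    exact hu.weak_eq φ hφ

lemma rpow_eq_abs_rpow_mul (hp : 1 < p) {a : ℝ} (ha : 0 ≤ a) : a ^ p = |a| ^ (p - 1) * a := by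
  rcases ha.eq_or_lt with h | h
  · rw [← h, Real.zero_rpow (by linarith), mul_zero]
  · rw [abs_of_pos h]
    nth_rewrite 3 [← Real.rpow_one a]
    rw [← Real.rpow_add h]
    ring_nf

namespace IsPreciseSolution

lemma integrable_rpow_mul (hu : IsPreciseSolution Ω s lam p u) (hE : Exponents N s p)
    {φ : Space N → ℝ} (hφ : MemHs s φ) : Integrable fun x => u x ^ p * φ x := by
  refine (hu.memHs.integrable_rpow_mul_mul hE hu.memHs hφ).congr
    (Filter.Eventually.of_forall fun x => ?_)
  simp only [rpow_eq_abs_rpow_mul hE.one_lt (hu.nonneg x)]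

/-- The weak equation with integrals over the whole space. -/
lemma energy_eq_integral (hu : IsPreciseSolution Ω s lam p u) (hE : Exponents N s p)
    {φ : Space N → ℝ} (hφ : MemHs0 Ω s φ) :
    energy s u φ = ∫ x, (u x ^ p - lam * u x) * φ x := by
  have h1 : ∫ x in Ω, u x * φ x = ∫ x, u x * φ x :=
    setIntegral_eq_integral_of_forall_compl_eq_zero fun x hx => by rw [hu.eq_zero x hx, zero_mul]
  have h2 : ∫ x in Ω, u x ^ p * φ x = ∫ x, u x ^ p * φ x :=
    setIntegral_eq_integral_of_forall_compl_eq_zero fun x hx => by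
      rw [hu.eq_zero x hx, Real.zero_rpow (by linarith [hE.one_lt]), zero_mul]
  have h3 := hu.weak_eq φ hφ
  rw [h1, h2] at h3
  have h4 : ∫ x, (u x ^ p - lam * u x) * φ x =
      (∫ x, u x ^ p * φ x) - lam * ∫ x, u x * φ x := by
    rw [← integral_const_mul, ← integral_sub (hu.integrable_rpow_mul hE hφ.1)
      ((hu.memHs.integrable_mul hφ.1).const_mul lam)]
    congr 1
    funext x
    ring
  rw [h4]
  linarith

lemma integrable_rhs (hu : IsPreciseSolution Ω s lam p u) (hE : Exponents N s p)
    {φ : Space N → ℝ} (hφ : MemHs s φ) : Integrable fun x => (u x ^ p - lam * u x) * φ x := by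
  refine ((hu.integrable_rpow_mul hE hφ).sub ((hu.memHs.integrable_mul hφ).const_mul lam)).congr
    (Filter.Eventually.of_forall fun x => ?_)
  simp only [Pi.sub_apply]
  ring

lemma comp_refl (hu : IsPreciseSolution Ω s lam p u) (hs : 0 < s)
    (hΩs : ∀ x, refl 0 x ∈ Ω ↔ x ∈ Ω) : IsPreciseSolution Ω s lam p fun x => u (refl 0 x) := by
  refine ⟨hu.measurable.comp measurable_refl, fun x => hu.nonneg _,
    fun x hx => hu.eq_zero _ (by rwa [hΩs]), hu.memHs.comp_refl 0, fun φ hφ => ?_⟩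
  have h1 := hu.weak_eq _ (hφ.comp_refl hΩs)
  rw [← energy_comp_refl (t := 0) hs hu.memHs (hφ.1.comp_refl 0),
    ← setIntegral_comp_refl hΩs (fun x => u x * φ (refl 0 x)),
    ← setIntegral_comp_refl hΩs (fun x => u x ^ p * φ (refl 0 x))] at h1
  simpa only [refl_refl] using h1

end IsPreciseSolution

/-- For `t ≥ 0`, the reflection at `{x₁ = t}` maps the cap `Ω ∩ {x₁ > t}` into `Ω`. -/
lemma refl_mem_of_mem_cap (hΩc : ConvexInFirstDirection Ω) (hΩs : ∀ x, refl 0 x ∈ Ω ↔ x ∈ Ω)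
    (ht : 0 ≤ t) {x : Space N} (hx : x ∈ Ω) (hxt : t < x 0) : refl t x ∈ Ω := by
  refine hΩc (refl 0 x) ((hΩs x).2 hx) x hx (fun i hi => refl_of_ne x hi) ?_
  have hx0 : 0 < x 0 := by linarith
  refine ⟨1 - t / x 0, t / x 0, sub_nonneg.2 ((div_le_one hx0).2 hxt.le), by positivity,
    by ring, ?_⟩
  ext i
  by_cases hi : i = 0
  · subst hi
    simp
    field_simp
    ring
  · simp [refl_of_ne _ hi]
    ring

lemma isOpen_halfSpace (t : ℝ) : IsOpen {x : Space N | t < x 0} :=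
  isOpen_lt continuous_const (by fun_prop)

/-- The part `Ω ∩ {x₁ > t}` of `Ω` beyond the hyperplane `{x₁ = t}`. -/
def cap (Ω : Set (Space N)) (t : ℝ) : Set (Space N) := {x | x ∈ Ω ∧ t < x 0}

lemma MemHs0.comp_refl_of_cap (hΩc : ConvexInFirstDirection Ω)
    (hΩs : ∀ x, refl 0 x ∈ Ω ↔ x ∈ Ω) (ht : 0 ≤ t) {φ : Space N → ℝ}
    (hφ : MemHs0 (cap Ω t) s φ) : MemHs0 Ω s (fun x => φ (refl t x)) := by
  refine ⟨hφ.1.comp_refl t, ?_⟩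
  filter_upwards [ae_refl (t := t) hφ.2] with x hx h
  refine hx fun h' => h ?_
  have := refl_mem_of_mem_cap hΩc hΩs ht h'.1 h'.2
  rwa [refl_refl] at this

lemma MemHs0.of_cap {φ : Space N → ℝ} (hφ : MemHs0 (cap Ω t) s φ) : MemHs0 Ω s φ :=
  ⟨hφ.1, hφ.2.mono fun _ h h' => h fun h'' => h' h''.1⟩

namespace IsPreciseSolution

/-- The equation satisfied in the cap by the difference of `u` and its reflection. -/
lemma weak_eq_sub_refl (hu : IsPreciseSolution Ω s lam p u) (hE : Exponents N s p)
    (hΩc : ConvexInFirstDirection Ω) (hΩs : ∀ x, refl 0 x ∈ Ω ↔ x ∈ Ω) (ht : 0 ≤ t)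
    {φ : Space N → ℝ} (hφ : MemHs0 (cap Ω t) s φ) :
    (Integrable fun x =>
      ((u x ^ p - lam * u x) - (u (refl t x) ^ p - lam * u (refl t x))) * φ x) ∧
    energy s (fun x => u x - u (refl t x)) φ =
      ∫ x, ((u x ^ p - lam * u x) - (u (refl t x) ^ p - lam * u (refl t x))) * φ x := by
  have hφr := hφ.comp_refl_of_cap hΩc hΩs ht
  have i1 := hu.integrable_rhs hE hφ.1
  have i2 : Integrable fun x => (u (refl t x) ^ p - lam * u (refl t x)) * φ x := by
    have := (measurePreserving_refl (N := N) (t := t)).integrable_comp_of_integrable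
      (hu.integrable_rhs hE hφr.1)
    refine this.congr (Filter.Eventually.of_forall fun x => ?_)
    simp only [Function.comp, refl_refl]
  simp only [sub_mul _ _ (φ _)] at i1 i2 ⊢
  refine ⟨i1.sub i2, ?_⟩
  rw [energy_sub_left hE.s_pos hu.memHs (hu.memHs.comp_refl t) hφ.1, integral_sub i1 i2]
  simp only [← sub_mul]
  rw [hu.energy_eq_integral hE hφ.of_cap]
  congr 1
  have h1 := energy_comp_refl (t := t) hE.s_pos hu.memHs hφr.1
  simp only [refl_refl] at h1
  rw [h1, hu.energy_eq_integral hE hφr,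
    ← integral_comp_refl (t := t) fun x => (u x ^ p - lam * u x) * φ (refl t x)]
  simp only [refl_refl]

lemma integrable_indicator_rpow (hu : IsPreciseSolution Ω s lam p u) (hE : Exponents N s p)
    (hΩ : IsOpen Ω) (hb : Bornology.IsBounded Ω) :
    Integrable (Ω.indicator fun x => (u x + 1) ^ (p + 1)) := by
  have h1 : Integrable (Ω.indicator fun _ : Space N => (1 : ℝ)) :=
    (integrable_indicator_iff hΩ.measurableSet).2 (integrableOn_const (hb.measure_lt_top).ne)
  have h2 := ((hu.memHs.integrable_rpow hE).add h1).const_mul (2 ^ (p + 1))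
  have hum := hu.measurable
  have hm : Measurable fun x => (u x + 1) ^ (p + 1) := by fun_prop
  have hp := hE.one_lt
  refine h2.mono' (hm.indicator hΩ.measurableSet).aestronglyMeasurable
    (Filter.Eventually.of_forall fun x => ?_)
  have hx := hu.nonneg x
  by_cases hxΩ : x ∈ Ω
  · simp only [Pi.add_apply, Set.indicator_of_mem hxΩ]
    rw [Real.norm_of_nonneg (by positivity), abs_of_nonneg hx]
    have h3 : 0 ≤ u x ^ (p + 1) := by positivity
    rcases le_total (u x) 1 with h | h
    · calc (u x + 1) ^ (p + 1) ≤ 2 ^ (p + 1) :=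
            Real.rpow_le_rpow (by positivity) (by linarith) (by linarith)
        _ ≤ _ := le_mul_of_one_le_right (by positivity) (by linarith)
    · calc (u x + 1) ^ (p + 1) ≤ (2 * u x) ^ (p + 1) :=
            Real.rpow_le_rpow (by positivity) (by linarith) (by linarith)
        _ = 2 ^ (p + 1) * u x ^ (p + 1) := Real.mul_rpow two_pos.le hx
        _ ≤ _ := mul_le_mul_of_nonneg_left (by linarith) (by positivity)
  · simp only [Set.indicator_of_notMem hxΩ, norm_zero, Pi.add_apply]
    positivity

end IsPreciseSolution

/-! ### The maximum principle in sets of small measure -/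

/-- Convexity of `a ↦ a ^ p`. -/
lemma rpow_sub_rpow_le (hp : 1 < p) {a b : ℝ} (ha : 0 < a) (hb : 0 ≤ b) :
    a ^ p - b ^ p ≤ p * a ^ (p - 1) * (a - b) := by
  have h1 := one_add_mul_self_le_rpow_one_add (s := b / a - 1) (by
    have : 0 ≤ b / a := by positivity
    linarith) hp.le
  rw [add_sub_cancel, Real.div_rpow hb ha.le, le_div_iff₀ (by positivity)] at h1
  have h2 : a ^ p = a ^ (p - 1) * a := by
    nth_rewrite 3 [← Real.rpow_one a]
    rw [← Real.rpow_add ha]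
    ring_nf
  have h3 : (1 + p * (b / a - 1)) * a ^ p = a ^ p - p * a ^ (p - 1) * (a - b) := by
    rw [h2]
    field_simp
    ring
  linarith

omit [NeZero N] in
/-- Hölder's inequality for a potential of power type restricted to a set. -/
lemma integral_indicator_rpow_mul_sq_le (hp : 1 < p) {A : Set (Space N)} (hA : MeasurableSet A)
    {f g : Space N → ℝ} (hf0 : ∀ x, 0 ≤ f x) (hfm : Measurable f)
    (hf : Integrable (A.indicator fun x => f x ^ (p + 1))) (hgm : AEStronglyMeasurable g)
    (hg : Integrable fun x => |g x| ^ (p + 1)) :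
    ∫ x, A.indicator (fun x => f x ^ (p - 1)) x * g x ^ 2 ≤
      (∫ x, A.indicator (fun x => f x ^ (p + 1)) x) ^ ((p - 1) / (p + 1)) *
        (∫ x, |g x| ^ (p + 1)) ^ (2 / (p + 1)) := by
  have hp1 : 0 < p - 1 := by linarith
  have hp2 : 0 < p + 1 := by linarith
  have hconj : ((p + 1) / (p - 1)).HolderConjugate ((p + 1) / 2) := by
    rw [Real.holderConjugate_iff]
    refine ⟨(one_lt_div hp1).2 (by linarith), ?_⟩
    field_simp
    ring
  have e1 : ∀ x, A.indicator (fun x => f x ^ (p - 1)) x ^ ((p + 1) / (p - 1)) =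
      A.indicator (fun x => f x ^ (p + 1)) x := fun x => by
    by_cases hx : x ∈ A
    · rw [Set.indicator_of_mem hx, Set.indicator_of_mem hx, ← Real.rpow_mul (hf0 x)]
      congr 1
      field_simp
    · rw [Set.indicator_of_notMem hx, Set.indicator_of_notMem hx,
        Real.zero_rpow (by positivity)]
  have e2 : ∀ x, (g x ^ 2) ^ ((p + 1) / 2) = |g x| ^ (p + 1) := fun x => by
    rw [← sq_abs, ← Real.rpow_natCast, ← Real.rpow_mul (abs_nonneg _)]
    congr 1
    push_cast
    ring
  have n1 : ∀ x, 0 ≤ A.indicator (fun x => f x ^ (p - 1)) x := fun x =>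
    Set.indicator_nonneg (fun x _ => Real.rpow_nonneg (hf0 x) _) x
  have m1 : MemLp (A.indicator fun x => f x ^ (p - 1)) (ENNReal.ofReal ((p + 1) / (p - 1))) := by
    refine (integrable_norm_rpow_iff ((by fun_prop : Measurable fun x => f x ^ (p - 1)).indicator
      hA).aestronglyMeasurable (by simp; positivity) ENNReal.ofReal_ne_top).1 ?_
    rw [ENNReal.toReal_ofReal (by positivity)]
    refine hf.congr (Filter.Eventually.of_forall fun x => ?_)
    simp only
    rw [Real.norm_of_nonneg (n1 x), e1]
  have m2 : MemLp (fun x => g x ^ 2) (ENNReal.ofReal ((p + 1) / 2)) := by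
    refine (integrable_norm_rpow_iff (hgm.pow 2) (by simp; positivity)
      ENNReal.ofReal_ne_top).1 ?_
    rw [ENNReal.toReal_ofReal (by positivity)]
    refine hg.congr (Filter.Eventually.of_forall fun x => ?_)
    simp only [Pi.pow_apply]
    rw [Real.norm_of_nonneg (sq_nonneg _), e2]
  have h := integral_mul_le_Lp_mul_Lq_of_nonneg hconj (Filter.Eventually.of_forall n1)
    (Filter.Eventually.of_forall fun x => sq_nonneg (g x)) m1 m2
  simp only [e1, e2, one_div_div] at h
  exact h

namespace IsPreciseSolution

/-- If the set where the antisymmetric difference has the wrong sign is small, it is negligible.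
The smallness is uniform in the position of the hyperplane. The negative part of the difference
is tested against the equation; by the Hölder and Sobolev inequalities the potential term is
absorbed by the energy. -/
theorem exists_forall_small (hu : IsPreciseSolution Ω s lam p u) (hE : Exponents N s p)
    (hΩ : IsOpen Ω) (hb : Bornology.IsBounded Ω)
    (hΩc : ConvexInFirstDirection Ω) (hΩs : ∀ x, refl 0 x ∈ Ω ↔ x ∈ Ω) :
    ∃ ε : ℝ, 0 < ε ∧ ∀ t, 0 ≤ t →
      (∫ x, {x : Space N | t < x 0 ∧ u (refl t x) < u x}.indicator
        (fun x => (u x + 1) ^ (p + 1)) x) < ε →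
      ∀ᵐ x : Space N, t < x 0 → u x ≤ u (refl t x) := by
  have hp := hE.one_lt
  have hp1 : 0 < p - 1 := by linarith
  have hp2 : 0 < p + 1 := by linarith
  have hs := hE.s_pos
  have hum := hu.measurable
  obtain ⟨C, hC, hsob⟩ := sobolev (N := N) (q := p + 1) hs (by linarith) hE.subcritical
  have hc := normConst_pos (N := N) hs hE.s_lt_one
  set c := normConst N s / 2 with hcdef
  have hc0 : 0 < c := by positivity
  set C₀ : ℝ := p + |lam| + c with hC₀
  have hC₀0 : 0 < C₀ := by positivity
  set θ := (p - 1) / (p + 1) with hθ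
  have hθ0 : 0 < θ := by positivity
  refine ⟨(c / (C₀ * C)) ^ θ⁻¹, by positivity, fun t ht hsmall => ?_⟩
  set A : Set (Space N) := {x | t < x 0 ∧ u (refl t x) < u x} with hA
  have hAm : MeasurableSet A := by
    exact (isOpen_halfSpace t).measurableSet.inter
      (measurableSet_lt (hum.comp measurable_refl) hum)
  have hApos : ∀ x ∈ A, 0 < u x := fun x hx => (hu.nonneg _).trans_lt hx.2
  have hAΩ : A ⊆ Ω := fun x hx => by
    by_contra h
    exact (hApos x hx).ne' (hu.eq_zero x h)
  set I := ∫ x, A.indicator (fun x => (u x + 1) ^ (p + 1)) x with hI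
  have hI0 : 0 ≤ I := integral_nonneg fun x => Set.indicator_nonneg (fun x _ => by
    have := hu.nonneg x
    positivity) x
  have hAi : Integrable (A.indicator fun x => (u x + 1) ^ (p + 1)) := by
    have := (hu.integrable_indicator_rpow hE hΩ hb).indicator hAm
    rwa [Set.indicator_indicator, Set.inter_eq_left.2 hAΩ] at this
  set d : Space N → ℝ := fun x => u x - u (refl t x) with hd
  have hds : MemHs s d := hu.memHs.sub (hu.memHs.comp_refl t)
  have hodd : ∀ x, d (refl t x) = -d x := fun x => by simp only [hd, refl_refl]; ring
  set g : Space N → ℝ := fun x => if t < x 0 then max (d x) 0 else 0 with hg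
  have hgs : MemHs s g := hds.oddPosPart hs hodd
  have hgA : ∀ x ∈ A, g x = d x := fun x hx => by
    simp only [hg, hx.1, if_true]
    exact max_eq_left (sub_nonneg.2 hx.2.le)
  have hgA' : ∀ x, x ∉ A → g x = 0 := fun x hx => by
    simp only [hg]
    split_ifs with h
    · exact max_eq_right (sub_nonpos.2 (not_lt.1 fun h' => hx ⟨h, h'⟩))
    · rfl
  have hgcap : MemHs0 (cap Ω t) s g :=
    ⟨hgs, Filter.Eventually.of_forall fun x hx => hgA' x fun h => hx ⟨hAΩ h, h.1⟩⟩
  obtain ⟨hwi, hweq⟩ := hu.weak_eq_sub_refl hE hΩc hΩs ht hgcap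
  have henergy : c * ∫ z, diffQuot s g z ^ 2 ≤
      ∫ x, ((u x ^ p - lam * u x) - (u (refl t x) ^ p - lam * u (refl t x))) * g x := by
    rw [← hweq]
    have := energy_oddPosPart_le hs hE.s_lt_one hds hodd
    rw [energy_eq hs] at this
    simpa only [sq] using this
  have hpot : Integrable fun x => A.indicator (fun x => (u x + 1) ^ (p - 1)) x * g x ^ 2 := by
    have h1 : Integrable fun x => |A.indicator (fun x => u x + 1) x| ^ (p + 1) := by
      refine hAi.congr (Filter.Eventually.of_forall fun x => ?_)
      by_cases hx : x ∈ A
      · simp only [Set.indicator_of_mem hx]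
        rw [abs_of_nonneg (by linarith [hu.nonneg x])]
      · simp only [Set.indicator_of_notMem hx, abs_zero]
        rw [Real.zero_rpow hp2.ne']
    have h2 := integrable_rpow_mul_mul hp
      ((hum.add_const 1).indicator hAm).aestronglyMeasurable hgs.1.1 hgs.1.1 h1
      (hgs.integrable_rpow hE) (hgs.integrable_rpow hE)
    refine h2.congr (Filter.Eventually.of_forall fun x => ?_)
    by_cases hx : x ∈ A
    · simp only [Set.indicator_of_mem hx]
      rw [abs_of_nonneg (by linarith [hu.nonneg x])]
      ring
    · simp [hgA' x hx]
  have hrhs : (∫ x, ((u x ^ p - lam * u x) - (u (refl t x) ^ p - lam * u (refl t x))) * g x) +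
      c * (∫ x, g x ^ 2) ≤
      C₀ * ∫ x, A.indicator (fun x => (u x + 1) ^ (p - 1)) x * g x ^ 2 := by
    rw [← integral_const_mul, ← integral_const_mul,
      ← integral_add hwi (hgs.1.integrable_sq.const_mul c)]
    refine integral_mono (hwi.add (hgs.1.integrable_sq.const_mul c)) (hpot.const_mul C₀)
      fun x => ?_
    by_cases hx : x ∈ A
    · simp only [Set.indicator_of_mem hx, hgA x hx]
      have hd0 : 0 < d x := sub_pos.2 hx.2
      have h1 := rpow_sub_rpow_le hp (hApos x hx) (hu.nonneg (refl t x))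
      have h2 : u x ^ (p - 1) ≤ (u x + 1) ^ (p - 1) :=
        Real.rpow_le_rpow (hu.nonneg x) (by linarith) hp1.le
      have h3 : 1 ≤ (u x + 1) ^ (p - 1) :=
        Real.one_le_rpow (by linarith [hu.nonneg x]) hp1.le
      have h4 : (u x ^ p - lam * u x) - (u (refl t x) ^ p - lam * u (refl t x)) ≤
          (p * u x ^ (p - 1) + |lam|) * d x := by
        have h5 : -lam * d x ≤ |lam| * d x :=
          mul_le_mul_of_nonneg_right (neg_le_abs lam) hd0.le
        simp only [hd] at h5 ⊢
        linarith
      have h6 : p * u x ^ (p - 1) + |lam| + c ≤ C₀ * (u x + 1) ^ (p - 1) := by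
        have h7 := mul_le_mul_of_nonneg_left h2 (by linarith : 0 ≤ p)
        have h8 := mul_le_mul_of_nonneg_left h3 (abs_nonneg lam)
        have h9 := mul_le_mul_of_nonneg_left h3 hc0.le
        rw [hC₀]
        linarith
      have h10 := mul_le_mul_of_nonneg_right h4 hd0.le
      have h11 := mul_le_mul_of_nonneg_right h6 (sq_nonneg (d x))
      linarith
    · simp [hgA' x hx]
  have hhold := integral_indicator_rpow_mul_sq_le hp hAm
    (fun x => by linarith [hu.nonneg x] : ∀ x, 0 ≤ u x + 1) (hum.add_const 1) hAi hgs.1.1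
    (hgs.integrable_rpow hE)
  set Q := normSqHs s g with hQ
  have hQ0 : 0 ≤ Q := normSqHs_nonneg g
  have hmain : c * Q ≤ C₀ * (I ^ θ * (C * Q)) := by
    calc c * Q = c * (∫ z, diffQuot s g z ^ 2) + c * ∫ x, g x ^ 2 := by
          rw [hQ, normSqHs, mul_add]
      _ ≤ C₀ * ∫ x, A.indicator (fun x => (u x + 1) ^ (p - 1)) x * g x ^ 2 := by linarith
      _ ≤ C₀ * (I ^ θ * (∫ x, |g x| ^ (p + 1)) ^ (2 / (p + 1))) :=
          mul_le_mul_of_nonneg_left hhold hC₀0.le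
      _ ≤ _ := by
          gcongr
          exact (hsob g hgs).2
  have hIθ : I ^ θ < c / (C₀ * C) := by
    have := Real.rpow_lt_rpow hI0 hsmall hθ0
    rwa [← Real.rpow_mul (by positivity), inv_mul_cancel₀ hθ0.ne', Real.rpow_one] at this
  rw [lt_div_iff₀ (by positivity)] at hIθ
  have hQz : Q = 0 := by
    by_contra h
    have : 0 < Q := lt_of_le_of_ne hQ0 (Ne.symm h)
    nlinarith
  have hg2 : ∫ x, g x ^ 2 = 0 := by
    have h1 : 0 ≤ ∫ x, g x ^ 2 := integral_nonneg fun _ => sq_nonneg _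
    have h2 : 0 ≤ ∫ z, diffQuot s g z ^ 2 := integral_nonneg fun _ => sq_nonneg _
    rw [hQ, normSqHs] at hQz
    linarith
  have hg0 := (integral_eq_zero_iff_of_nonneg (fun _ => sq_nonneg _) hgs.1.integrable_sq).1 hg2
  filter_upwards [hg0] with x hx hxt
  by_contra h
  have hxA : x ∈ A := ⟨hxt, not_le.1 h⟩
  have h1 : g x = 0 := by simpa using hx
  rw [hgA x hxA] at h1
  exact (sub_pos.2 hxA.2).ne' h1

end IsPreciseSolution

end

section

variable {N : ℕ} [NeZero N] {s p lam t : ℝ} {Ω : Set (Space N)} {u : Space N → ℝ}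

/-! ### Moving planes -/

/-- Reflections of an `L²` function depend continuously on the hyperplane; along a subsequence
the convergence is pointwise almost everywhere. -/
lemma exists_seq_tendsto_comp_refl {f : Space N → ℝ} (hf : MemLp f 2) {τ : ℕ → ℝ}
    (hτ : Filter.Tendsto τ Filter.atTop (nhds t)) :
    ∃ ns : ℕ → ℕ, StrictMono ns ∧ ∀ᵐ x, Filter.Tendsto (fun n => f (refl (τ (ns n)) x))
      Filter.atTop (nhds (f (refl t x))) := by
  have hg : MemLp (fun x => f (refl 0 x)) 2 := hf.comp_measurePreserving measurePreserving_refl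
  -- The reflection at `{x₁ = r}` is a translation by `-2r` followed by the reflection at `0`.
  set e : ℝ → Space N := fun r => EuclideanSpace.single 0 (-(2 * r)) with he
  have hrefl : ∀ r (x : Space N), refl 0 (e r +ᵥ x) = refl r x := fun r x => by
    ext i
    by_cases hi : i = 0
    · subst hi
      simp [he]
      ring
    · simp [he, refl_of_ne _ hi, hi]
  have : Fact ((2 : ENNReal) ≠ ⊤) := ⟨by simp⟩
  have hcont : Continuous fun r => DomAddAct.mk (e r) +ᵥ hg.toLp _ := by
    have h1 : Continuous e := by
      have h2 : e = fun r => (-(2 * r)) • EuclideanSpace.single (0 : Fin N) (1 : ℝ) := by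
        funext r
        ext i
        by_cases hi : i = 0
        · subst hi; simp [he]
        · simp [he, hi]
      rw [h2]
      fun_prop
    exact (DomAddAct.continuous_mk.comp h1).vadd continuous_const
  have h1 := tendstoInMeasure_of_tendsto_Lp ((hcont.tendsto t).comp hτ)
  obtain ⟨ns, hns, h2⟩ := h1.exists_seq_tendsto_ae
  refine ⟨ns, hns, ?_⟩
  have hae : ∀ r, (DomAddAct.mk (e r) +ᵥ hg.toLp _ : Lp ℝ 2 (volume : Measure (Space N)))
      =ᵐ[volume] fun x => f (refl r x) := fun r => by
    rw [DomAddAct.mk_vadd_toLp]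
    refine (MemLp.coeFn_toLp _).trans (Filter.Eventually.of_forall fun x => ?_)
    simp only [hrefl]
  filter_upwards [h2, hae t, ae_all_iff.2 fun n => hae (τ (ns n))] with x h3 h4 h5
  rw [h4] at h3
  exact h3.congr h5

namespace IsPreciseSolution

/-- A solution that vanishes on a non-empty open subset of `Ω` is zero: positive values elsewhere
would make its fractional Laplacian negative there. -/
lemma ae_eq_zero_of_ae_eq_zero_on (hu : IsPreciseSolution Ω s lam p u) (hE : Exponents N s p)
    {O : Set (Space N)} (hO : IsOpen O) (hb : Bornology.IsBounded O) (hne : O.Nonempty)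
    (hOΩ : O ⊆ Ω) (h0 : ∀ᵐ x, x ∈ O → u x = 0) : u =ᵐ[volume] 0 := by
  have hs := hE.s_pos
  have hc := normConst_pos (N := N) hs hE.s_lt_one
  have hχ := memHs0_cutoff hs hE.s_lt_one hO hb
  have hχΩ : MemHs0 Ω s (cutoff O) := ⟨hχ.1, hχ.2.mono fun x h h' => h fun h'' => h' (hOΩ h'')⟩
  have huχ : ∀ᵐ x, u x * cutoff O x = 0 := by
    filter_upwards [h0] with x hx
    by_cases hxO : x ∈ O
    · rw [hx hxO, zero_mul]
    · rw [cutoff_of_notMem hxO, mul_zero]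
  have hE0 : energy s u (cutoff O) = 0 := by
    rw [hu.energy_eq_integral hE hχΩ]
    refine integral_eq_zero_of_ae ?_
    filter_upwards [huχ] with x hx
    rcases mul_eq_zero.1 hx with h | h
    · simp [h, Real.zero_rpow (by linarith [hE.one_lt] : p ≠ 0)]
    · simp [h]
  have hi := hu.memHs.integrable_diffQuot_mul hχ.1
  rw [energy_eq hs] at hE0
  have hint := (mul_eq_zero.1 hE0).resolve_left (by positivity)
  have hpt : ∀ᵐ z : Space N × Space N, diffQuot s u z * diffQuot s (cutoff O) z =
      -(kernel s z.1 z.2 * (u z.1 * cutoff O z.2 + u z.2 * cutoff O z.1)) := by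
    filter_upwards [ae_fst huχ, ae_snd huχ] with z h1 h2
    rw [diffQuot_mul_eq_kernel hs]
    linear_combination kernel s z.1 z.2 * (h1 + h2)
  have hnn : ∀ z : Space N × Space N,
      0 ≤ kernel s z.1 z.2 * (u z.1 * cutoff O z.2 + u z.2 * cutoff O z.1) := fun z =>
    mul_nonneg (kernel_nonneg _ _) (add_nonneg (mul_nonneg (hu.nonneg _) (cutoff_nonneg _ _))
      (mul_nonneg (hu.nonneg _) (cutoff_nonneg _ _)))
  have hi2 := (hi.congr hpt).neg
  rw [integral_congr_ae hpt, integral_neg, neg_eq_zero] at hint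
  have hz := (integral_eq_zero_iff_of_nonneg hnn (by simpa [Pi.neg_def] using hi2)).1 hint
  have hfin : ∀ᵐ z : Space N × Space N, ¬ (z.1 ∈ O ∧ u z.2 ≠ 0) := by
    filter_upwards [hz, ae_fst_ne_snd] with z hz hne
    rintro ⟨h1, h2⟩
    have h3 : 0 < u z.2 := lt_of_le_of_ne (hu.nonneg _) (Ne.symm h2)
    have h4 := mul_nonneg (hu.nonneg z.1) (cutoff_nonneg O z.2)
    have h5 := mul_pos h3 (cutoff_pos hO hb h1)
    have h6 := kernel_pos (s := s) hne
    exact (mul_pos h6 (by linarith : 0 < u z.1 * cutoff O z.2 + u z.2 * cutoff O z.1)).ne' hz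
  rcases ae_or_ae_of_prod (P := fun x => x ∈ O) (Q := fun x => u x ≠ 0) hfin with h | h
  · exfalso
    rw [ae_iff] at h
    simp only [not_not] at h
    exact (hO.measure_pos volume hne).ne' h
  · filter_upwards [h] with x hx
    simpa using hx

/-- If a solution is symmetric with respect to a hyperplane `{x₁ = t}` with `t > 0`, it vanishes:
the points of `Ω` far to the left are mapped outside `Ω`. -/
lemma ae_eq_zero_of_symmetric (hu : IsPreciseSolution Ω s lam p u) (hE : Exponents N s p)
    (hΩ : IsOpen Ω) (hb : Bornology.IsBounded Ω) (hne : Ω.Nonempty)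
    (hΩs : ∀ x, refl 0 x ∈ Ω ↔ x ∈ Ω) (ht : 0 < t)
    (h : ∀ᵐ x : Space N, t < x 0 → u x = u (refl t x)) : u =ᵐ[volume] 0 := by
  have hbd : BddAbove ((fun x : Space N => x 0) '' Ω) := by
    obtain ⟨R, hR⟩ := hb.exists_norm_le
    refine ⟨R, ?_⟩
    rintro _ ⟨x, hx, rfl⟩
    exact (le_abs_self _).trans ((PiLp.norm_apply_le x 0).trans (hR x hx))
  set T := sSup ((fun x : Space N => x 0) '' Ω) with hT
  obtain ⟨_, ⟨y, hy, rfl⟩, hyT⟩ := exists_lt_of_lt_csSup (hne.image fun x : Space N => x 0)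
    (show T - 2 * t < T by linarith)
  set O : Set (Space N) := Ω ∩ {x | x 0 < 2 * t - T} with hO
  refine hu.ae_eq_zero_of_ae_eq_zero_on hE (O := O)
    (hΩ.inter (isOpen_lt (by fun_prop) continuous_const)) (hb.subset Set.inter_subset_left)
    ⟨refl 0 y, (hΩs y).2 hy, ?_⟩ Set.inter_subset_left ?_
  · simp only [Set.mem_ofPred_eq, refl_zero]
    linarith
  · filter_upwards [h, ae_refl (t := t) h, ae_ne_zero_coord t] with x h1 h2 h3 hx
    have h4 : u (refl t x) = 0 := hu.eq_zero _ fun h' => by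
      have h5 := le_csSup hbd ⟨_, h', rfl⟩
      simp only [refl_zero] at h5
      have h6 : x 0 < 2 * t - T := hx.2
      linarith
    rcases h3.lt_or_gt with h3 | h3
    · rw [refl_refl, refl_zero, h4] at h2
      exact (h2 (by linarith)).symm
    · rw [h1 h3, h4]

/-- A non-zero solution that lies below its reflection beyond `{x₁ = t}` does so strictly. -/
lemma ae_lt_of_ae_le (hu : IsPreciseSolution Ω s lam p u) (hE : Exponents N s p)
    (hΩ : IsOpen Ω) (hb : Bornology.IsBounded Ω) (hne : Ω.Nonempty)
    (hΩc : ConvexInFirstDirection Ω) (hΩs : ∀ x, refl 0 x ∈ Ω ↔ x ∈ Ω) (ht : 0 < t)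
    (hu0 : ¬ u =ᵐ[volume] 0) (h : ∀ᵐ x : Space N, t < x 0 → u x ≤ u (refl t x)) :
    ∀ᵐ x, x ∈ cap Ω t → u x < u (refl t x) := by
  have hw : MemHs s (fun x => u (refl t x) - u x) := (hu.memHs.comp_refl t).sub hu.memHs
  have hneg : ∀ φ : Space N → ℝ, energy s (fun x => u (refl t x) - u x) φ =
      -energy s (fun x => u x - u (refl t x)) φ := fun φ => by
    rw [← neg_one_mul, ← energy_mul_left hE.s_pos]
    congr 1
    funext x
    ring
  have key := strong_maximum_principle hE.s_pos hE.s_lt_one (D := cap Ω t) (t := t)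
    (w := fun x => u (refl t x) - u x)
    (F := fun x => -((u x ^ p - lam * u x) - (u (refl t x) ^ p - lam * u (refl t x))))
    (hΩ.inter (isOpen_halfSpace t)) (hb.subset fun x hx => hx.1) (fun x hx => hx.2)
    ((hu.measurable.comp measurable_refl).sub hu.measurable) hw
    (fun x => by rw [refl_refl]; ring)
    (by filter_upwards [h] with x hx hxt using sub_nonneg.2 (hx hxt))
    (fun φ hφ => (hu.weak_eq_sub_refl hE hΩc hΩs ht.le hφ).1.neg.congr
      (Filter.Eventually.of_forall fun x => (neg_mul _ _).symm))
    (fun φ hφ => by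
      rw [hneg, (hu.weak_eq_sub_refl hE hΩc hΩs ht.le hφ).2, ← integral_neg]
      simp only [neg_mul])
    (fun x hx => by rw [sub_eq_zero.1 hx]; ring)
  rcases key with key | key
  · filter_upwards [key, h] with x h1 h2 h3
    exact lt_of_le_of_ne (h2 h3.2) fun h4 => h1 h3 (sub_eq_zero.2 h4.symm)
  · exact absurd (hu.ae_eq_zero_of_symmetric hE hΩ hb hne hΩs ht
      (by filter_upwards [key] with x hx hxt using (sub_eq_zero.1 (hx hxt)).symm)) hu0

/-- The plane can be moved: if `u` lies below its reflection beyond `{x₁ = t}` with `t > 0`, the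
same is true for planes slightly to the left. -/
lemma exists_forall_lt (hu : IsPreciseSolution Ω s lam p u) (hE : Exponents N s p)
    (hΩ : IsOpen Ω) (hb : Bornology.IsBounded Ω) (hne : Ω.Nonempty)
    (hΩc : ConvexInFirstDirection Ω) (hΩs : ∀ x, refl 0 x ∈ Ω ↔ x ∈ Ω) (ht : 0 < t)
    (hu0 : ¬ u =ᵐ[volume] 0) (h : ∀ᵐ x : Space N, t < x 0 → u x ≤ u (refl t x)) :
    ∃ δ, 0 < δ ∧ ∀ r, t - δ < r → r < t → ∀ᵐ x : Space N, r < x 0 → u x ≤ u (refl r x) := by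
  by_contra hcon
  push Not at hcon
  have hτ : ∀ n : ℕ, ∃ r, t - min t (1 / ((n : ℝ) + 1)) < r ∧ r < t ∧
      ¬ ∀ᵐ x : Space N, r < x 0 → u x ≤ u (refl r x) := fun n => by
    obtain ⟨r, h1, h2, h3⟩ := hcon (min t (1 / ((n : ℝ) + 1))) (lt_min ht (by positivity))
    exact ⟨r, h1, h2, fun h4 => h3 (by simpa using h4)⟩
  choose τ hτ1 hτ2 hτ3 using hτ
  have hτ0 : ∀ n, 0 ≤ τ n := fun n => by
    linarith [hτ1 n, min_le_left t (1 / ((n : ℝ) + 1))]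
  have hτlim : Filter.Tendsto τ Filter.atTop (nhds t) := by
    have h1 : Filter.Tendsto (fun n : ℕ => t - 1 / ((n : ℝ) + 1)) Filter.atTop (nhds t) := by
      simpa using tendsto_one_div_add_atTop_nhds_zero_nat.const_sub t
    refine tendsto_of_tendsto_of_tendsto_of_le_of_le h1 tendsto_const_nhds (fun n => ?_)
      fun n => (hτ2 n).le
    have := min_le_right t (1 / ((n : ℝ) + 1))
    exact le_of_lt (lt_of_le_of_lt (by linarith) (hτ1 n))
  obtain ⟨ns, hns, hlim⟩ := exists_seq_tendsto_comp_refl hu.memHs.1 hτlim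
  obtain ⟨ε, hε, hsmall⟩ := hu.exists_forall_small hE hΩ hb hΩc hΩs
  have hlt := hu.ae_lt_of_ae_le hE hΩ hb hne hΩc hΩs ht hu0 h
  set A : ℕ → Set (Space N) := fun n => {x | τ (ns n) < x 0 ∧ u (refl (τ (ns n)) x) < u x}
    with hA
  set f : Space N → ℝ := fun x => (u x + 1) ^ (p + 1) with hf
  have hum := hu.measurable
  have hfm : Measurable f := by fun_prop
  have hf0 : ∀ x, 0 ≤ f x := fun x => by
    have := hu.nonneg x
    positivity
  have hAm : ∀ n, MeasurableSet (A n) := fun n =>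
    (isOpen_halfSpace _).measurableSet.inter (measurableSet_lt (hum.comp measurable_refl) hum)
  have hAΩ : ∀ n, A n ⊆ Ω := fun n x hx => by
    by_contra h'
    exact (((hu.nonneg _).trans_lt hx.2).ne') (hu.eq_zero x h')
  have hτns : Filter.Tendsto (fun n => τ (ns n)) Filter.atTop (nhds t) :=
    hτlim.comp hns.tendsto_atTop
  have hint : Filter.Tendsto (fun n => ∫ x, (A n).indicator f x) Filter.atTop (nhds 0) := by
    have h1 := tendsto_integral_of_dominated_convergence (μ := volume)
      (F := fun n => (A n).indicator f) (f := fun _ => 0) (Ω.indicator f)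
      (fun n => (hfm.indicator (hAm n)).aestronglyMeasurable)
      (hu.integrable_indicator_rpow hE hΩ hb)
      (fun n => Filter.Eventually.of_forall fun x => by
        rw [Real.norm_of_nonneg (Set.indicator_nonneg (fun x _ => hf0 x) x)]
        exact Set.indicator_le_indicator_of_subset (hAΩ n) hf0 x)
      (by
        filter_upwards [hlim, hlt, ae_ne_zero_coord t] with x h1 h2 h3
        -- Almost every point eventually leaves the sets `A n`.
        have h4 : ∀ᶠ n in Filter.atTop, x ∉ A n := by
          by_cases hxΩ : x ∈ Ω
          · rcases h3.lt_or_gt with h3 | h3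
            · filter_upwards [hτns.eventually_const_lt h3] with n hn hx
              exact lt_asymm hn hx.1
            · filter_upwards [h1.eventually_const_lt (h2 ⟨hxΩ, h3⟩)] with n hn hx
              exact lt_asymm hn hx.2
          · exact Filter.Eventually.of_forall fun n hx => hxΩ (hAΩ n hx)
        refine tendsto_const_nhds.congr' ?_
        filter_upwards [h4] with n hn
        rw [Set.indicator_of_notMem hn])
    simpa using h1
  obtain ⟨n, hn⟩ := (hint.eventually_lt_const hε).exists
  exact hτ3 (ns n) (hsmall (τ (ns n)) (hτ0 _) hn)

/-- Moving planes from the right up to the symmetry hyperplane of `Ω`. -/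
lemma ae_le_refl (hu : IsPreciseSolution Ω s lam p u) (hE : Exponents N s p)
    (hΩ : IsOpen Ω) (hb : Bornology.IsBounded Ω) (hne : Ω.Nonempty)
    (hΩc : ConvexInFirstDirection Ω) (hΩs : ∀ x, refl 0 x ∈ Ω ↔ x ∈ Ω) :
    ∀ᵐ x : Space N, 0 < x 0 → u x ≤ u (refl 0 x) := by
  by_cases hu0 : u =ᵐ[volume] 0
  · filter_upwards [hu0, ae_refl (t := 0) hu0] with x h1 h2 _
    rw [h1, h2]
    simp
  set P : ℝ → Prop := fun t => ∀ᵐ x : Space N, t < x 0 → u x ≤ u (refl t x) with hP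
  have hclosed : ∀ (τ : ℕ → ℝ) t, Filter.Tendsto τ Filter.atTop (nhds t) → (∀ n, P (τ n)) →
      P t := fun τ t hτ hPτ => by
    obtain ⟨ns, hns, hlim⟩ := exists_seq_tendsto_comp_refl hu.memHs.1 hτ
    filter_upwards [hlim, ae_all_iff.2 fun n => hPτ (ns n)] with x h1 h2 hx
    refine ge_of_tendsto h1 ?_
    filter_upwards [(hτ.comp hns.tendsto_atTop).eventually_lt_const hx] with n hn
    exact h2 n hn
  obtain ⟨R, hR⟩ := hb.exists_norm_le
  have hlarge : ∀ t, R ≤ t → P t := fun t ht => Filter.Eventually.of_forall fun x hx => by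
    rw [hu.eq_zero x fun h => ?_]
    · exact hu.nonneg _
    · have := (le_abs_self _).trans ((PiLp.norm_apply_le x 0).trans (hR x h))
      linarith
  set S : Set ℝ := {t | 0 ≤ t ∧ ∀ r, t ≤ r → P r} with hS
  have hSne : S.Nonempty := ⟨max R 0, le_max_right _ _, fun r hr =>
    hlarge r ((le_max_left _ _).trans hr)⟩
  have hSb : BddBelow S := ⟨0, fun t ht => ht.1⟩
  set t₀ := sInf S with ht₀
  have ht₀0 : 0 ≤ t₀ := le_csInf hSne fun t ht => ht.1
  have habove : ∀ r, t₀ < r → P r := fun r hr => by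
    obtain ⟨t, ht, htr⟩ := exists_lt_of_csInf_lt hSne hr
    exact ht.2 r htr.le
  have hPt₀ : P t₀ := by
    refine hclosed (fun n : ℕ => t₀ + 1 / ((n : ℝ) + 1)) t₀ ?_ fun n => habove _ ?_
    · simpa using tendsto_one_div_add_atTop_nhds_zero_nat.const_add t₀
    · have : 0 < 1 / ((n : ℝ) + 1) := by positivity
      linarith
  rcases ht₀0.eq_or_lt with h0 | h0
  · rw [← h0] at hPt₀
    exact hPt₀
  · exfalso
    obtain ⟨δ, hδ, hleft⟩ := hu.exists_forall_lt hE hΩ hb hne hΩc hΩs h0 hu0 hPt₀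
    have hmem : max 0 (t₀ - δ / 2) ∈ S := by
      refine ⟨le_max_left _ _, fun r hr => ?_⟩
      have h1 := (le_max_right _ _).trans hr
      rcases lt_trichotomy r t₀ with h | h | h
      · exact hleft r (by linarith) h
      · rw [h]; exact hPt₀
      · exact habove r h
    have h2 := csInf_le hSb hmem
    rcases le_max_iff.1 h2 with h3 | h3 <;> linarith

/-- Solutions are symmetric, by moving planes from both sides. -/
theorem ae_symmetric (hu : IsPreciseSolution Ω s lam p u) (hE : Exponents N s p)
    (hΩ : IsOpen Ω) (hb : Bornology.IsBounded Ω) (hne : Ω.Nonempty)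
    (hΩc : ConvexInFirstDirection Ω) (hΩs : ∀ x, refl 0 x ∈ Ω ↔ x ∈ Ω) :
    ∀ᵐ x : Space N, u (refl 0 x) = u x := by
  have h1 := hu.ae_le_refl hE hΩ hb hne hΩc hΩs
  have h2 := (hu.comp_refl hE.s_pos hΩs).ae_le_refl hE hΩ hb hne hΩc hΩs
  simp only [refl_refl] at h2
  have h3 : ∀ᵐ x : Space N, 0 < x 0 → u (refl 0 x) = u x := by
    filter_upwards [h1, h2] with x h1 h2 h3 using le_antisymm (h2 h3) (h1 h3)
  filter_upwards [h3, ae_refl (t := 0) h3, ae_ne_zero_coord 0] with x h4 h5 h6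
  rcases h6.lt_or_gt with h6 | h6
  · rw [refl_refl, refl_zero] at h5
    exact (h5 (by linarith)).symm
  · exact h4 h6

end IsPreciseSolution

end

end

end FractionalDirichlet

theorem proposition3p5 (N : ℕ) [NeZero N] (s lam p : ℝ) (Ω : Set (Space N))
    (hs0 : 0 < s) (hs1 : s < 1)
    (hp : 1 < p) (hp_crit : 2 * s < N → p ≤ 2 * N / (N - 2 * s) - 1)
    (hΩ : IsSmoothBoundedDomain Ω)
    (hΩ_convex : ConvexInFirstDirection Ω) (hΩ_symm : SymmetricInFirstDirection Ω)
    (hlam : -firstDirichletEigenvalue Ω s < lam)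
    (u : Space N → ℝ) (hu : IsNonnegSolution Ω s lam p u)
    (μ₂ : ℝ) (hμ₂ : IsSecondEigenvalue Ω s lam p u μ₂)
    (v : Space N → ℝ) (hv : IsEigenfunction Ω s lam p u μ₂ v) :
    IsEigenfunction Ω s lam p u μ₂ (polarization v) := by
  have hE := Exponents.of_le hs0 hs1 hp hp_crit
  have hm := hΩ.isOpen.measurableSet
  have hΩs : ∀ x, refl 0 x ∈ Ω ↔ x ∈ Ω := fun x => by rw [← reflection_eq]; exact hΩ_symm x
  obtain ⟨u', hae, hu'⟩ := hu.exists_precise hs0 hm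
  have hsym := hu'.ae_symmetric hE hΩ.isOpen hΩ.isBounded hΩ.isConnected.nonempty hΩ_convex hΩs
  refine hμ₂.isEigenfunction_polarization hE hm hΩs hu.mem.1 ?_ hv
  filter_upwards [hae, ae_refl (t := 0) hae, hsym] with x h1 h2 h3
  rw [h1, h2, h3]
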